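/- Let $R$ be a commutative Noetherian ring; all modules are finitely generated $R$-modules. Let $K$ be a semidualizing $R$-module, i.e. the homothety map $R\to\operatorname{Hom}_R(K,K)$ is bijective and $\operatorname{Ext}^i_R(K,K)=0$ for all $i>0$; $K$ is called dualizing if moreover it has finite injective dimension. Let $n\ge 0$ be an integer. The grade of $M$ is $\operatorname{gr}_R(M)=\inf\{i\mid \operatorname{Ext}^i_R(M,R)\ne 0\}$. Let $\mathcal P_K(R)$ be the class of modules isomorphic to $P\otimes_R K$ with $P$ (finitely generated) projective. Let $\mathcal G(\mathcal P_K)$ be the class of modules isomorphic to $\operatorname{coker}(X_1\to X_0)$ for some exact complex $X=(\cdots\to X_1\to X_0\to X_{-1}\to\cdots)$ of modules in $\mathcal P_K(R)$ which stays exact under $\operatorname{Hom}_R(T,-)$ and $\operatorname{Hom}_R(-,T)$ for all $T\in\mathcal P_K(R)$. The $\mathcal P_K$-dimension (resp. $\mathcal G(\mathcal P_K)$-dimension) of $M$ is the infimum of the lengths $\sup\{i\mid X_i\neq0\}$ of the exact sequences $\cdots\to X_1\to X_0\to M\to 0$ with all $X_i$ in $\mathcal P_K(R)$ (resp. in $\mathcal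 G(\mathcal P_K)$). The module $M$ is $\mathcal P_K$-perfect (resp. $\mathcal G(\mathcal P_K)$-perfect) if $\operatorname{gr}_R(M)$ equals its $\mathcal P_K$-dimension (resp. its $\mathcal G(\mathcal P_K)$-dimension), and $\mathcal P^n_K(R)$ denotes the class of $\mathcal P_K$-perfect modules of grade $n$. Let $\operatorname{Epi}(\mathcal P^n_K(R))$ be the class of surjective homomorphisms $\phi:Y\to M$ with $Y\in\mathcal P_K^n(R)$ and $\operatorname{gr}_R(M)=\operatorname{gr}_R(Y)$. For such $\phi$ with kernel inclusion $i:\ker\phi\to Y$, let $\mathcal L^n_K(\phi)$ be the surjection from $\operatorname{Ext}^n_R(\operatorname{Hom}_R(K,Y),K)$ onto the image of the map $\operatorname{Ext}^n_R(\operatorname{Hom}_R(K,i),K)$ to $\operatorname{Ext}^n_R(\operatorname{Hom}_R(K,\ker\phi),K)$. Write $\phi\equiv\psi$ for homomorphisms $\phi:X\to M$ and $\psi:Y\to N$ if there are isomorphisms $\beta:X\to Y$ and $\alpha:M\to N$ with $\psi\beta=\alpha\phi$. Modules $M,N$ are directly colinked with respect to $\mathcal P^n_K(R)$ if there are $\phi:Y\to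 M$ and $\psi:Y'\to N$ in $\operatorname{Epi}(\mathcal P^n_K(R))$ with $\phi\equiv\mathcal L^n_K(\psi)$ and $\psi\equiv\mathcal L^n_K(\phi)$. The coliaison classes with respect to $\mathcal P^n_K(R)$ are the classes of the equivalence relation generated by direct colinkage. Theorem. Let $M$ and $N$ be $R$-modules in the same coliaison class with respect to $\mathcal P^n_K(R)$. Then: (i) $M$ is $\mathcal P_K$-perfect if and only if $N$ is $\mathcal P_K$-perfect. (ii) If $K$ is dualizing, then $M$ is $\mathcal G(\mathcal P_K)$-perfect if and only if $N$ is $\mathcal G(\mathcal P_K)$-perfect. -/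

import Mathlib

open CategoryTheory CategoryTheory.Abelian
open scoped TensorProduct

universe u

namespace Colinkage

noncomputable section

section

variable {R : Type u} [CommRing R]

/-! ### Grade, semidualizing and dualizing modules -/

/-- The grade `inf {i | Ext^i_R(M, R) ≠ 0}`; it is `⊤` when all these modules vanish. -/
def grade (M : ModuleCat.{u} R) : ℕ∞ :=
  ⨅ (i : ℕ) (_ : Nontrivial (Ext M (ModuleCat.of R R) i)), (i : ℕ∞)

/-- `K` is semidualizing: it is finitely generated, the homothety map `R → Hom_R(K, K)` is
bijective and `Ext^i_R(K, K) = 0` for all `i > 0`. -/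
structure IsSemidualizing (K : ModuleCat.{u} R) : Prop where
  finite : Module.Finite R K
  homothety_bijective : Function.Bijective (LinearMap.lsmul R K)
  ext_eq_zero : ∀ i : ℕ, 0 < i → Subsingleton (Ext K K i)

/-- A dualizing module is a semidualizing module of finite injective dimension. -/
structure IsDualizing (K : ModuleCat.{u} R) : Prop extends IsSemidualizing K where
  finite_injectiveDimension : ∃ d : ℕ, HasInjectiveDimensionLE K d

/-! ### Resolutions by a class of modules and the resulting dimension -/

/-- A resolution `⋯ → X₁ → X₀ → M → 0` of `M` (an exact sequence) by modules in the class `C`. -/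
structure Resolution (C : ModuleCat.{u} R → Prop) (M : ModuleCat.{u} R) where
  X : ℕ → ModuleCat.{u} R
  d : ∀ i, X (i + 1) →ₗ[R] X i
  aug : X 0 →ₗ[R] M
  mem : ∀ i, C (X i)
  aug_surjective : Function.Surjective aug
  exact_zero : Function.Exact (d 0) aug
  exact_succ : ∀ i, Function.Exact (d (i + 1)) (d i)

/-- The length `sup {i | X_i ≠ 0}` of a resolution. -/
def Resolution.length {C : ModuleCat.{u} R → Prop} {M : ModuleCat.{u} R} (P : Resolution C M) :
    WithBot ℕ∞ :=
  ⨆ (i : ℕ) (_ : Nontrivial (P.X i)), ((i : ℕ∞) : WithBot ℕ∞)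

/-- The infimum of the lengths of the resolutions of `M` by modules in `C`; it is `⊤` if there is
no resolution of finite length, and `⊥` for the zero module (when zero modules are in `C`). -/
def resolutionDim (C : ModuleCat.{u} R → Prop) (M : ModuleCat.{u} R) : WithBot ℕ∞ :=
  ⨅ P : Resolution C M, P.length

/-! ### `K`-projective modules and `P_K`-perfect modules -/

/-- The class `P_K(R)` of the modules `P ⊗_R K`, with `P` finitely generated projective. -/
def IsKProjective (K X : ModuleCat.{u} R) : Prop :=
  ∃ P : ModuleCat.{u} R, Module.Finite R P ∧ Module.Projective R P ∧ Nonempty (X ≃ₗ[R] P ⊗[R] K)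

/-- The `P_K`-dimension. -/
def pkDim (K M : ModuleCat.{u} R) : WithBot ℕ∞ :=
  resolutionDim (IsKProjective K) M

/-- `M` is `P_K`-perfect: it is finitely generated and its grade is its `P_K`-dimension. -/
def IsPKPerfect (K M : ModuleCat.{u} R) : Prop :=
  Module.Finite R M ∧ (grade M : WithBot ℕ∞) = pkDim K M

/-- The class `P_K^n(R)` of the `P_K`-perfect modules of grade `n`. -/
def PKPerfectOfGrade (K : ModuleCat.{u} R) (n : ℕ) (M : ModuleCat.{u} R) : Prop :=
  IsPKPerfect K M ∧ grade M = n

/-! ### The class `G(P_K)` and `G(P_K)`-perfect modules -/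

/-- A (homologically indexed, two-sided) complex `X` of modules in `P_K(R)` is totally
`P_K`-acyclic: it is exact, and stays exact under `Hom_R(T, -)` and `Hom_R(-, T)` for every
`T` in `P_K(R)`. -/
structure IsTotallyPKAcyclic (K : ModuleCat.{u} R) (X : ChainComplex (ModuleCat.{u} R) ℤ) :
    Prop where
  mem : ∀ i, IsKProjective K (X.X i)
  exact : ∀ i, Function.Exact (X.d (i + 1) i) (X.d i (i - 1))
  exact_hom_from : ∀ (T : ModuleCat.{u} R), IsKProjective K T → ∀ i,
    Function.Exact (fun f : T ⟶ X.X (i + 1) => f ≫ X.d (i + 1) i)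
      (fun f : T ⟶ X.X i => f ≫ X.d i (i - 1))
  exact_hom_to : ∀ (T : ModuleCat.{u} R), IsKProjective K T → ∀ i,
    Function.Exact (fun f : X.X (i - 1) ⟶ T => X.d i (i - 1) ≫ f)
      (fun f : X.X i ⟶ T => X.d (i + 1) i ≫ f)

/-- The class `G(P_K)` of the modules isomorphic to the cokernel of `X₁ → X₀` for a totally
`P_K`-acyclic complex `X`. -/
def IsGPK (K M : ModuleCat.{u} R) : Prop :=
  ∃ X : ChainComplex (ModuleCat.{u} R) ℤ, IsTotallyPKAcyclic K X ∧
    Nonempty (M ≃ₗ[R] X.X 0 ⧸ LinearMap.range (X.d 1 0).hom)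

/-- The `G(P_K)`-dimension. -/
def gpkDim (K M : ModuleCat.{u} R) : WithBot ℕ∞ :=
  resolutionDim (IsGPK K) M

/-- `M` is `G(P_K)`-perfect: it is finitely generated and its grade is its `G(P_K)`-dimension. -/
def IsGPKPerfect (K M : ModuleCat.{u} R) : Prop :=
  Module.Finite R M ∧ (grade M : WithBot ℕ∞) = gpkDim K M

/-! ### Colinkage -/

/-- `φ : Y → M` belongs to `Epi(C)`: it is surjective, `Y` is in `C`, `M` is finitely generated,
and `M` has the same grade as `Y`. -/
structure IsEpiOf (C : ModuleCat.{u} R → Prop) {Y M : ModuleCat.{u} R} (φ : Y ⟶ M) : Prop where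
  mem : C Y
  finite : Module.Finite R M
  surjective : Function.Surjective φ
  grade_eq : grade M = grade Y

/-- Equivalence of homomorphisms: isomorphisms `β` of the sources and `α` of the targets making
the square commute. -/
def EquivHom {X M Y N : ModuleCat.{u} R} (φ : X ⟶ M) (ψ : Y ⟶ N) : Prop :=
  ∃ (α : M ≅ N) (β : X ≅ Y), β.hom ≫ ψ = φ ≫ α.hom

/-- `Hom_R(K, M)` as an `R`-module. -/
abbrev homK (K M : ModuleCat.{u} R) : ModuleCat.{u} R :=
  ModuleCat.of R (K →ₗ[R] M)

/-- `Hom_R(K, f) : Hom_R(K, M) → Hom_R(K, N)`. -/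
def homKMap (K : ModuleCat.{u} R) {M N : ModuleCat.{u} R} (f : M ⟶ N) : homK K M ⟶ homK K N :=
  ModuleCat.ofHom (f.hom.compRight R)

/-- The `R`-linear map `Ext^n_R(Hom_R(K, f), K)` from `Ext^n_R(Hom_R(K, N), K)` to
`Ext^n_R(Hom_R(K, M), K)`. -/
def dualMap (K : ModuleCat.{u} R) (n : ℕ) {M N : ModuleCat.{u} R} (f : M ⟶ N) :
    Ext (homK K N) K n →ₗ[R] Ext (homK K M) K n :=
  (Ext.mk₀ (homKMap K f)).precompOfLinear R K (zero_add n)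

/-- The inclusion `ker φ → Y` of the kernel of `φ : Y → M`. -/
def kerIncl {Y M : ModuleCat.{u} R} (φ : Y ⟶ M) : ModuleCat.of R (LinearMap.ker φ.hom) ⟶ Y :=
  ModuleCat.ofHom (LinearMap.ker φ.hom).subtype

/-- For `φ : Y → M` with kernel inclusion `i : ker φ → Y`, the epimorphism `𝓛_K^n(φ)` from
`Ext^n_R(Hom_R(K, Y), K)` onto the image of `Ext^n_R(Hom_R(K, i), K)`. -/
def colinkHom (K : ModuleCat.{u} R) (n : ℕ) {Y M : ModuleCat.{u} R} (φ : Y ⟶ M) :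
    ModuleCat.of R (Ext (homK K Y) K n) ⟶
      ModuleCat.of R (LinearMap.range (dualMap K n (kerIncl φ))) :=
  ModuleCat.ofHom (dualMap K n (kerIncl φ)).rangeRestrict

/-- `M` and `N` are directly colinked with respect to `C`: there are `φ : Y ↠ M` and
`ψ : Y' ↠ N` in `Epi(C)` with `φ ≡ 𝓛_K^n(ψ)` and `ψ ≡ 𝓛_K^n(φ)`. -/
def DirectlyColinked (K : ModuleCat.{u} R) (n : ℕ) (C : ModuleCat.{u} R → Prop)
    (M N : ModuleCat.{u} R) : Prop :=
  ∃ (Y Y' : ModuleCat.{u} R) (φ : Y ⟶ M) (ψ : Y' ⟶ N),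
    IsEpiOf C φ ∧ IsEpiOf C ψ ∧
      EquivHom φ (colinkHom K n ψ) ∧ EquivHom ψ (colinkHom K n φ)

/-- The coliaison relation with respect to `C`: the equivalence relation generated by direct
colinkage. -/
def SameColiaisonClass (K : ModuleCat.{u} R) (n : ℕ) (C : ModuleCat.{u} R → Prop) :
    ModuleCat.{u} R → ModuleCat.{u} R → Prop :=
  Relation.EqvGen (DirectlyColinked K n C)

end

end

end Colinkage

/-! Both claims are one statement about a pair of classes (`IsDualPair`): a resolving class C and a
class D such that Hom(K,-) carries D to C, Hom(-,K) carries C to D, and positive Ext vanishes from K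
into D and from C into K. It is applied with D = P_K and C the finitely generated projectives and,
for K dualizing, with D = G(P_K) and C the totally reflexive modules.

For a module N of grade n, being D-perfect means having a D-resolution of length at most n. Indeed
Ext^i(N,K) vanishes for i < n, hence so does Ext^i(N,X) for X in D, and a shorter resolution would
force Hom(N,N) = 0 (`IsDualPair.grade_eq_iff`).

Let φ : Y → M be in Epi, with M of D-dimension at most n; Y has D-dimension at most n as well.
Hom(K,-) keeps 0 → ker φ → Y → M → 0 exact, because the evaluations K ⊗ Hom(K,-) → - are bijective
at Y and M. Since C is resolving, L = Hom(K, ker φ) has C-dimension at most n. It is killed by ann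
Y, so Ext^i(L,K) = 0 for i < n, and the dual of a C-resolution of L resolves Ext^n(L,K) by D in
length n. As Ext^{n+1}(Hom(K,M),K) = 0, the image that defines the target of 𝓛(φ) is all of
Ext^n(L,K) (`IsDualPair.dimLE_colink`). Direct colinkage is symmetric, so the property is constant
on coliaison classes. -/

namespace Colinkage

noncomputable section

/-! ### Short exact sequences and their long exact Ext sequences -/

section ShortExactSequences

variable {R : Type u} [CommRing R]

/-- `0 → A → B → C → 0` is exact. -/
structure IsSES {A B C : ModuleCat.{u} R} (f : A →ₗ[R] B) (g : B →ₗ[R] C) : Prop where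
  inj : Function.Injective f
  exact : Function.Exact f g
  surj : Function.Surjective g

namespace IsSES

variable {A B C : ModuleCat.{u} R} {f : A →ₗ[R] B} {g : B →ₗ[R] C} (h : IsSES f g)
include h

lemma comp_eq_zero : g ∘ₗ f = 0 := h.exact.linearMap_comp_eq_zero

lemma shortExact :
    (ModuleCat.shortComplexOfCompEqZero f g h.comp_eq_zero).ShortExact :=
  ModuleCat.shortComplex_shortExact _ h.exact h.inj h.surj

lemma ext_left_of_mid {X : ModuleCat.{u} R} {i : ℕ} (hB : Subsingleton (Ext X B (i + 1)))
    (hC : Subsingleton (Ext X C i)) : Subsingleton (Ext X A (i + 1)) := by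
  refine subsingleton_of_forall_eq 0 fun x => ?_
  obtain ⟨y, rfl⟩ := Ext.covariant_sequence_exact₁ X h.shortExact x
    (Subsingleton.elim (α := Ext X B (i + 1)) _ _) rfl
  rw [Subsingleton.elim (α := Ext X C i) y 0, Ext.zero_comp]

lemma ext_right_of_mid {X : ModuleCat.{u} R} {i : ℕ} (hB : Subsingleton (Ext X B i))
    (hA : Subsingleton (Ext X A (i + 1))) : Subsingleton (Ext X C i) := by
  refine subsingleton_of_forall_eq 0 fun x => ?_
  obtain ⟨y, rfl⟩ := Ext.covariant_sequence_exact₃ X h.shortExact x rfl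
    (Subsingleton.elim (α := Ext X A (i + 1)) _ _)
  rw [Subsingleton.elim (α := Ext X B i) y 0, Ext.zero_comp]

lemma ext_zero_left {X : ModuleCat.{u} R} (hB : Subsingleton (Ext X B 0)) :
    Subsingleton (Ext X A 0) := by
  have := h.shortExact.mono_f
  exact (Ext.postcomp_mk₀_injective_of_mono X
    (ModuleCat.shortComplexOfCompEqZero f g h.comp_eq_zero).f).subsingleton

lemma ext_right_of_mid' {Y : ModuleCat.{u} R} {i : ℕ} (hB : Subsingleton (Ext B Y (i + 1)))
    (hA : Subsingleton (Ext A Y i)) : Subsingleton (Ext C Y (i + 1)) := by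
  refine subsingleton_of_forall_eq 0 fun x => ?_
  obtain ⟨y, rfl⟩ := Ext.contravariant_sequence_exact₃ h.shortExact Y x
    (Subsingleton.elim (α := Ext B Y (i + 1)) _ _) (add_comm 1 i)
  rw [Subsingleton.elim (α := Ext A Y i) y 0, Ext.comp_zero]

lemma ext_mid' {Y : ModuleCat.{u} R} {i : ℕ} (hA : Subsingleton (Ext A Y i))
    (hC : Subsingleton (Ext C Y i)) : Subsingleton (Ext B Y i) := by
  refine subsingleton_of_forall_eq 0 fun x => ?_
  obtain ⟨y, rfl⟩ := Ext.contravariant_sequence_exact₂ h.shortExact Y x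
    (Subsingleton.elim (α := Ext A Y i) _ _)
  rw [Subsingleton.elim (α := Ext C Y i) y 0, Ext.comp_zero]

lemma ext_left_of_mid' {Y : ModuleCat.{u} R} {i : ℕ} (hB : Subsingleton (Ext B Y i))
    (hC : Subsingleton (Ext C Y (i + 1))) : Subsingleton (Ext A Y i) := by
  refine subsingleton_of_forall_eq 0 fun x => ?_
  obtain ⟨y, rfl⟩ := Ext.contravariant_sequence_exact₁ h.shortExact Y x (add_comm 1 i)
    (Subsingleton.elim (α := Ext C Y (i + 1)) _ _)
  rw [Subsingleton.elim (α := Ext B Y i) y 0, Ext.comp_zero]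

lemma extend_of_ext {Y : ModuleCat.{u} R} (hC : Subsingleton (Ext C Y 1)) (a : A →ₗ[R] Y) :
    ∃ b : B →ₗ[R] Y, b ∘ₗ f = a := by
  obtain ⟨y, hy⟩ := Ext.contravariant_sequence_exact₁ h.shortExact Y
    (Ext.mk₀ (ModuleCat.ofHom a)) (add_zero 1) (Subsingleton.elim (α := Ext C Y 1) _ _)
  obtain ⟨b, rfl⟩ := (Ext.mk₀_bijective _ _).2 y
  rw [Ext.mk₀_comp_mk₀] at hy
  exact ⟨b.hom, congrArg ModuleCat.Hom.hom ((Ext.mk₀_bijective _ _).1 hy)⟩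

lemma lift_of_ext {X : ModuleCat.{u} R} (hA : Subsingleton (Ext X A 1)) (c : X →ₗ[R] C) :
    ∃ b : X →ₗ[R] B, g ∘ₗ b = c := by
  obtain ⟨y, hy⟩ := Ext.covariant_sequence_exact₃ X h.shortExact
    (Ext.mk₀ (ModuleCat.ofHom c)) (zero_add 1) (Subsingleton.elim (α := Ext X A 1) _ _)
  obtain ⟨b, rfl⟩ := (Ext.mk₀_bijective _ _).2 y
  rw [Ext.mk₀_comp_mk₀] at hy
  exact ⟨b.hom, congrArg ModuleCat.Hom.hom ((Ext.mk₀_bijective _ _).1 hy)⟩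

/-- The connecting map Hom(A,Y) → Ext^1(C,Y) is onto and kills every map that extends to B. Together
with `ext_one_of_lift` this turns Hom-exactness of a complex into Ext vanishing. -/
lemma ext_one_of_extend {Y : ModuleCat.{u} R} (hB : Subsingleton (Ext B Y 1))
    (H : ∀ a : A →ₗ[R] Y, ∃ b : B →ₗ[R] Y, b ∘ₗ f = a) : Subsingleton (Ext C Y 1) := by
  refine subsingleton_of_forall_eq 0 fun x => ?_
  obtain ⟨y, rfl⟩ := Ext.contravariant_sequence_exact₃ h.shortExact Y x
    (Subsingleton.elim (α := Ext B Y 1) _ _) (add_zero 1)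
  obtain ⟨a, rfl⟩ := (Ext.mk₀_bijective _ _).2 y
  obtain ⟨b, hb⟩ := H a.hom
  have : a = (ModuleCat.shortComplexOfCompEqZero f g h.comp_eq_zero).f ≫ ModuleCat.ofHom b :=
    ModuleCat.hom_ext hb.symm
  rw [this, ← Ext.mk₀_comp_mk₀, h.shortExact.extClass_comp_assoc]

lemma ext_one_of_lift {X : ModuleCat.{u} R} (hB : Subsingleton (Ext X B 1))
    (H : ∀ c : X →ₗ[R] C, ∃ b : X →ₗ[R] B, g ∘ₗ b = c) : Subsingleton (Ext X A 1) := by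
  refine subsingleton_of_forall_eq 0 fun x => ?_
  obtain ⟨y, rfl⟩ := Ext.covariant_sequence_exact₁ X h.shortExact x
    (Subsingleton.elim (α := Ext X B 1) _ _) (zero_add 1)
  obtain ⟨c, rfl⟩ := (Ext.mk₀_bijective _ _).2 y
  obtain ⟨b, hb⟩ := H c.hom
  have : c = ModuleCat.ofHom b ≫ (ModuleCat.shortComplexOfCompEqZero f g h.comp_eq_zero).g :=
    ModuleCat.hom_ext hb.symm
  rw [this, ← Ext.mk₀_comp_mk₀, Ext.comp_assoc_of_second_deg_zero, h.shortExact.comp_extClass,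
    Ext.comp_zero]

/-- The connecting map `Ext^i(A, Y) → Ext^{i+1}(C, Y)`. -/
def delta (Y : ModuleCat.{u} R) (i : ℕ) : Ext A Y i →ₗ[R] Ext C Y (i + 1) :=
  h.shortExact.extClass.precompOfLinear R Y (add_comm 1 i)

lemma delta_bijective {Y : ModuleCat.{u} R} {i : ℕ} (h₀ : Subsingleton (Ext B Y i))
    (h₁ : Subsingleton (Ext B Y (i + 1))) : Function.Bijective (h.delta Y i) := by
  constructor
  · rw [injective_iff_map_eq_zero]
    intro x hx
    obtain ⟨y, rfl⟩ := Ext.contravariant_sequence_exact₁ h.shortExact Y x (add_comm 1 i) hx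
    rw [Subsingleton.elim (α := Ext B Y i) y 0, Ext.comp_zero]
  · intro x
    exact Ext.contravariant_sequence_exact₃ h.shortExact Y x
      (Subsingleton.elim (α := Ext B Y (i + 1)) _ _) (add_comm 1 i)

/-- The connecting map `Hom(A, Y) → Ext^1(C, Y)`. -/
def deltaHom (Y : ModuleCat.{u} R) : (A →ₗ[R] Y) →ₗ[R] Ext C Y 1 :=
  h.delta Y 0 ∘ₗ (Ext.linearEquiv₀ (R := R)).symm.toLinearMap ∘ₗ
    (ModuleCat.homLinearEquiv (S := R)).symm.toLinearMap

lemma exact_deltaHom (Y : ModuleCat.{u} R) :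
    Function.Exact (f.lcomp R Y) (h.deltaHom Y) := by
  intro a
  constructor
  · intro ha
    obtain ⟨y, hy⟩ := Ext.contravariant_sequence_exact₁ h.shortExact Y
      (Ext.mk₀ (ModuleCat.ofHom a)) (add_zero 1) ha
    obtain ⟨b, rfl⟩ := (Ext.mk₀_bijective _ _).2 y
    rw [Ext.mk₀_comp_mk₀] at hy
    exact ⟨b.hom, congrArg ModuleCat.Hom.hom ((Ext.mk₀_bijective _ _).1 hy)⟩
  · rintro ⟨b, rfl⟩
    have : ModuleCat.ofHom (b ∘ₗ f) =
      (ModuleCat.shortComplexOfCompEqZero f g h.comp_eq_zero).f ≫ ModuleCat.ofHom b := rfl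
    change h.shortExact.extClass.comp (Ext.mk₀ (ModuleCat.ofHom (b ∘ₗ f))) (add_zero 1) = 0
    rw [this, ← Ext.mk₀_comp_mk₀, h.shortExact.extClass_comp_assoc]

lemma deltaHom_surjective {Y : ModuleCat.{u} R} (hB : Subsingleton (Ext B Y 1)) :
    Function.Surjective (h.deltaHom Y) := by
  intro x
  obtain ⟨y, rfl⟩ := Ext.contravariant_sequence_exact₃ h.shortExact Y x
    (Subsingleton.elim (α := Ext B Y 1) _ _) (add_zero 1)
  obtain ⟨a, rfl⟩ := (Ext.mk₀_bijective _ _).2 y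
  exact ⟨a.hom, rfl⟩

lemma exists_desc {Y : ModuleCat.{u} R} (b : B →ₗ[R] Y) (hb : b ∘ₗ f = 0) :
    ∃ c : C →ₗ[R] Y, c ∘ₗ g = b := by
  have hk : LinearMap.ker g ≤ LinearMap.ker b := by
    intro x hx
    obtain ⟨a, rfl⟩ := (h.exact x).1 hx
    exact LinearMap.congr_fun hb a
  refine ⟨(LinearMap.ker g).liftQ b hk ∘ₗ (g.quotKerEquivOfSurjective h.surj).symm.toLinearMap,
    LinearMap.ext fun x => ?_⟩
  change (LinearMap.ker g).liftQ b hk ((g.quotKerEquivOfSurjective h.surj).symm (g x)) = b x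
  have : (g.quotKerEquivOfSurjective h.surj).symm (g x) = (LinearMap.ker g).mkQ x := by
    rw [LinearEquiv.symm_apply_eq]; rfl
  rw [this]; rfl

lemma exists_factor {X : ModuleCat.{u} R} (v : X →ₗ[R] B) (hv : g ∘ₗ v = 0) :
    ∃ w : X →ₗ[R] A, f ∘ₗ w = v := by
  have hr : ∀ x, v x ∈ LinearMap.range f := fun x => (h.exact _).1 (LinearMap.congr_fun hv x)
  exact ⟨(LinearEquiv.ofInjective f h.inj).symm.toLinearMap ∘ₗ v.codRestrict _ hr,
    LinearMap.ext fun x => congrArg Subtype.val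
      ((LinearEquiv.ofInjective f h.inj).apply_symm_apply ⟨v x, hr x⟩)⟩

/-- The short exact sequence `0 → Hom(C, Y) → Hom(B, Y) → Hom(A, Y) → 0`. -/
lemma hom_contra {Y : ModuleCat.{u} R}
    (H : ∀ a : A →ₗ[R] Y, ∃ b : B →ₗ[R] Y, b ∘ₗ f = a) :
    IsSES (A := homK C Y) (B := homK B Y) (C := homK A Y) (g.lcomp R Y) (f.lcomp R Y) where
  inj a b hab := LinearMap.ext fun c => by
    obtain ⟨b, rfl⟩ := h.surj c
    exact LinearMap.congr_fun hab b
  exact := by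
    intro b
    constructor
    · intro hb
      exact h.exists_desc b hb
    · rintro ⟨c, rfl⟩
      refine LinearMap.ext fun a => ?_
      change c (g (f a)) = 0
      rw [h.exact.apply_apply_eq_zero, map_zero]
  surj a := H a

/-- The short exact sequence `0 → Hom(X, A) → Hom(X, B) → Hom(X, C) → 0`. -/
lemma hom_co {X : ModuleCat.{u} R}
    (H : ∀ c : X →ₗ[R] C, ∃ b : X →ₗ[R] B, g ∘ₗ b = c) :
    IsSES (A := homK X A) (B := homK X B) (C := homK X C) (f.compRight R) (g.compRight R) where
  inj a b hab := LinearMap.ext fun c => h.inj (LinearMap.congr_fun hab c)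
  exact := by
    intro b
    constructor
    · intro hb
      exact h.exists_factor b hb
    · rintro ⟨c, rfl⟩
      refine LinearMap.ext fun a => ?_
      exact h.exact.apply_apply_eq_zero (c a)
  surj c := H c

end IsSES

lemma ext_subsingleton_of_projective (P : ModuleCat.{u} R) [Module.Projective R P]
    (Y : ModuleCat.{u} R) (i : ℕ) : Subsingleton (Ext P Y (i + 1)) := by
  have := (IsProjective.iff_projective (R := R) P).1 inferInstance
  exact subsingleton_of_forall_eq 0 fun x => Ext.eq_zero_of_projective x

/-- `X` is a retract of a finite power of `Y`, in terms of coordinates. -/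
def IsSummandOfPower (X Y : ModuleCat.{u} R) : Prop :=
  ∃ (m : ℕ) (a : Fin m → (X →ₗ[R] Y)) (b : Fin m → (Y →ₗ[R] X)),
    ∑ j, b j ∘ₗ a j = LinearMap.id

lemma IsSummandOfPower.of_equiv {X Y : ModuleCat.{u} R} (e : X ≃ₗ[R] Y) :
    IsSummandOfPower X Y :=
  ⟨1, fun _ => e.toLinearMap, fun _ => e.symm.toLinearMap, by
    ext x; simp⟩

lemma IsSummandOfPower.ext_right {X Y : ModuleCat.{u} R} (h : IsSummandOfPower X Y)
    {N : ModuleCat.{u} R} {i : ℕ} (hN : Subsingleton (Ext N Y i)) : Subsingleton (Ext N X i) := by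
  obtain ⟨m, a, b, hab⟩ := h
  refine subsingleton_of_forall_eq 0 fun x => ?_
  have h1 : 𝟙 X = ∑ j, ModuleCat.ofHom (a j) ≫ ModuleCat.ofHom (b j) := by
    ext1
    rw [ModuleCat.hom_sum]
    exact hab.symm
  rw [← Ext.comp_mk₀_id x, h1, Ext.mk₀_sum, Ext.comp_sum]
  refine Finset.sum_eq_zero fun j _ => ?_
  rw [← Ext.mk₀_comp_mk₀, ← Ext.comp_assoc_of_second_deg_zero,
    Subsingleton.elim (α := Ext N Y i) (x.comp (Ext.mk₀ (ModuleCat.ofHom (a j))) _) 0,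
    Ext.zero_comp]

lemma IsSummandOfPower.ext_left {X Y : ModuleCat.{u} R} (h : IsSummandOfPower X Y)
    {N : ModuleCat.{u} R} {i : ℕ} (hN : Subsingleton (Ext Y N i)) : Subsingleton (Ext X N i) := by
  obtain ⟨m, a, b, hab⟩ := h
  refine subsingleton_of_forall_eq 0 fun x => ?_
  have h1 : 𝟙 X = ∑ j, ModuleCat.ofHom (a j) ≫ ModuleCat.ofHom (b j) := by
    ext1
    rw [ModuleCat.hom_sum]
    exact hab.symm
  rw [← Ext.mk₀_id_comp x, h1, Ext.mk₀_sum, Ext.sum_comp]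
  refine Finset.sum_eq_zero fun j _ => ?_
  rw [← Ext.mk₀_comp_mk₀_assoc,
    Subsingleton.elim (α := Ext Y N i) ((Ext.mk₀ (ModuleCat.ofHom (b j))).comp x _) 0,
    Ext.comp_zero]

lemma ext_subsingleton_of_equiv_right {X Y N : ModuleCat.{u} R} (e : X ≃ₗ[R] Y) {i : ℕ}
    (hN : Subsingleton (Ext N Y i)) : Subsingleton (Ext N X i) :=
  (IsSummandOfPower.of_equiv e).ext_right hN

lemma ext_zero_subsingleton_iff {X Y : ModuleCat.{u} R} :
    Subsingleton (Ext X Y 0) ↔ Subsingleton (X →ₗ[R] Y) :=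
  (Ext.addEquiv₀.trans ModuleCat.homAddEquiv).subsingleton_congr

end ShortExactSequences

/-! ### Evaluation maps and faithfulness of a semidualizing module -/

section Semidualizing

open scoped Pointwise

variable {R : Type u} [CommRing R]

/-- The evaluation map `K ⊗ Hom(K, X) → X`. -/
def evK (K X : ModuleCat.{u} R) : K ⊗[R] (K →ₗ[R] X) →ₗ[R] X :=
  TensorProduct.lift (LinearMap.id (R := R) (M := K →ₗ[R] X)).flip

@[simp]
lemma evK_tmul (K X : ModuleCat.{u} R) (k : K) (h : K →ₗ[R] X) : evK K X (k ⊗ₜ h) = h k := rfl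

lemma evK_naturality (K : ModuleCat.{u} R) {X Y : ModuleCat.{u} R} (f : X →ₗ[R] Y)
    (t : K ⊗[R] (K →ₗ[R] X)) : evK K Y ((f.compRight R).lTensor K t) = f (evK K X t) := by
  induction t with
  | zero => simp
  | tmul k h => simp
  | add a b ha hb => simp only [map_add, ha, hb]

namespace IsKProjective

variable {K : ModuleCat.{u} R}

lemma of_equiv {X X' : ModuleCat.{u} R} (h : IsKProjective K X) (e : X' ≃ₗ[R] X) :
    IsKProjective K X' := by
  obtain ⟨P, h1, h2, ⟨e'⟩⟩ := h
  exact ⟨P, h1, h2, ⟨e.trans e'⟩⟩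

lemma dual (V : ModuleCat.{u} R) [Module.Finite R V] [Module.Projective R V] :
    IsKProjective K (homK V K) :=
  ⟨ModuleCat.of R (Module.Dual R V), inferInstanceAs (Module.Finite R (Module.Dual R V)),
    inferInstanceAs (Module.Projective R (Module.Dual R V)), ⟨(dualTensorHomEquiv R V K).symm⟩⟩

lemma isSummandOfPower {X : ModuleCat.{u} R} (h : IsKProjective K X) :
    IsSummandOfPower X K := by
  obtain ⟨P, h1, h2, ⟨e⟩⟩ := h
  obtain ⟨m, f, g, -, -, hfg⟩ := Module.Finite.exists_comp_eq_id_of_projective R P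
  refine ⟨m, fun j => (TensorProduct.lid R K).toLinearMap ∘ₗ
    (LinearMap.proj j ∘ₗ g).rTensor K ∘ₗ e.toLinearMap,
    fun j => e.symm.toLinearMap ∘ₗ TensorProduct.mk R P K (f (Pi.single j 1)), ?_⟩
  have key : ∀ t : P ⊗[R] K, ∑ j, f (Pi.single j 1) ⊗ₜ[R]
      TensorProduct.lid R K ((LinearMap.proj j ∘ₗ g).rTensor K t) = t := by
    intro t
    induction t with
    | zero => simp
    | tmul p k =>
      have h3 : ∑ j, g p j • f (Pi.single j 1) = p := by
        have hp : f (g p) = p := LinearMap.congr_fun hfg p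
        conv_rhs => rw [← hp, pi_eq_sum_univ' (g p)]
        simp only [map_sum, map_smul]
      conv_rhs => rw [← h3]
      simp [TensorProduct.sum_tmul, TensorProduct.smul_tmul]
    | add a b ha hb =>
      simp only [map_add, TensorProduct.tmul_add, Finset.sum_add_distrib, ha, hb]
  ext x
  have := congrArg e.symm (key (e x))
  simpa [LinearMap.sum_apply] using this

end IsKProjective

namespace IsSemidualizing

variable {K : ModuleCat.{u} R} (hK : IsSemidualizing K)
include hK

/-- The homothety isomorphism `R ≃ Hom(K, K)`. -/
def homothety : R ≃ₗ[R] (K →ₗ[R] K) :=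
  LinearEquiv.ofBijective (LinearMap.lsmul R K) hK.homothety_bijective

lemma homothety_symm_smul (f : K →ₗ[R] K) (k : K) : hK.homothety.symm f • k = f k :=
  LinearMap.congr_fun (hK.homothety.apply_symm_apply f) k

/-- With coordinates a_j : X → K and b_j : K → X, the inverse of evaluation is x ↦ ∑ a_j(x) ⊗ b_j.
Each a_j ∘ h is a homothety, so h is a combination of the b_j with scalars in R, and these scalars
move across the tensor. -/
lemma evK_bijective {X : ModuleCat.{u} R} (h : IsSummandOfPower X K) :
    Function.Bijective (evK K X) := by
  obtain ⟨m, a, b, hab⟩ := h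
  have hx : ∀ x, ∑ j, b j (a j x) = x := fun x => by
    simpa [LinearMap.sum_apply] using LinearMap.congr_fun hab x
  constructor
  · refine Function.LeftInverse.injective (g := fun x => ∑ j, a j x ⊗ₜ b j) fun t => ?_
    induction t with
    | zero => simp
    | tmul k h =>
      have : h = ∑ j, hK.homothety.symm (a j ∘ₗ h) • b j := by
        ext k
        rw [← hx (h k)]
        simp only [LinearMap.sum_apply, LinearMap.smul_apply, ← map_smul, homothety_symm_smul]
        rfl
      conv_rhs => rw [this, TensorProduct.tmul_sum]
      refine Finset.sum_congr rfl fun j _ => ?_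
      rw [TensorProduct.tmul_smul, TensorProduct.smul_tmul', homothety_symm_smul]
      rfl
    | add s t hs ht =>
      simp only [map_add, TensorProduct.add_tmul, Finset.sum_add_distrib] at hs ht ⊢
      rw [hs, ht]
  · intro x
    exact ⟨∑ j, a j x ⊗ₜ b j, by simp [map_sum, hx]⟩

/-- `Hom(K, X)` is a retract of a finite free module when `X` is a retract of a power of `K`. -/
lemma homK_retract {X : ModuleCat.{u} R} (h : IsSummandOfPower X K) :
    ∃ (m : ℕ) (i : (K →ₗ[R] X) →ₗ[R] (Fin m → R)) (s : (Fin m → R) →ₗ[R] (K →ₗ[R] X)),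
      s ∘ₗ i = LinearMap.id := by
  obtain ⟨m, a, b, hab⟩ := h
  refine ⟨m, LinearMap.pi fun j => hK.homothety.symm.toLinearMap ∘ₗ (a j).compRight R,
    ∑ j, (LinearMap.toSpanSingleton R _ (b j)) ∘ₗ LinearMap.proj j, ?_⟩
  ext h k
  have hx := LinearMap.congr_fun hab (h k)
  rw [LinearMap.id_apply] at hx
  conv_rhs => rw [LinearMap.id_apply, ← hx]
  simp only [LinearMap.comp_apply, LinearMap.sum_apply, LinearMap.proj_apply, LinearMap.pi_apply,
    LinearMap.toSpanSingleton_apply, LinearMap.smul_apply, ← map_smul, LinearEquiv.coe_coe,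
    homothety_symm_smul]
  rfl

lemma homK_finite_projective {X : ModuleCat.{u} R} (h : IsSummandOfPower X K) :
    Module.Finite R (K →ₗ[R] X) ∧ Module.Projective R (K →ₗ[R] X) := by
  obtain ⟨m, i, s, his⟩ := hK.homK_retract h
  exact ⟨Module.Finite.of_surjective s fun x => ⟨i x, LinearMap.congr_fun his x⟩,
    Module.Projective.of_split i s his⟩

lemma ext_K_eq_zero {X : ModuleCat.{u} R} (h : IsSummandOfPower X K) (i : ℕ) :
    Subsingleton (Ext K X (i + 1)) :=
  h.ext_right (hK.ext_eq_zero _ i.succ_pos)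

variable [IsNoetherianRing R]

/-- Over a Noetherian ring Hom(K,E) = 0 yields an E-regular element of ann K. Injectivity of the
homothety map makes ann K zero, so 0 is E-regular and E = 0. -/
lemma subsingleton_of_hom (E : Type*) [AddCommGroup E] [Module R E] [Module.Finite R E]
    (h : Subsingleton (K →ₗ[R] E)) : Subsingleton E := by
  have := hK.finite
  obtain ⟨x, hx, hreg⟩ := IsSMulRegular.subsingleton_linearMap_iff.1 h
  have hx0 : x = 0 := hK.homothety_bijective.1 (by
    ext k
    rw [LinearMap.lsmul_apply, LinearMap.lsmul_apply, zero_smul]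
    exact Module.mem_annihilator.1 hx k)
  subst hx0
  exact ⟨fun a b => hreg (by simp)⟩

lemma subsingleton_of_tensor (C : Type u) [AddCommGroup C] [Module R C] [Module.Finite R C]
    (h : Subsingleton (K ⊗[R] C)) : Subsingleton C := by
  have h1 : Subsingleton (K →ₗ[R] C →ₗ[R] C) :=
    (TensorProduct.lift.equiv (RingHom.id R) K C C).toEquiv.subsingleton
  have h2 := hK.subsingleton_of_hom (C →ₗ[R] C) h1
  have h3 : (LinearMap.id : C →ₗ[R] C) = 0 := Subsingleton.elim _ _
  exact subsingleton_of_forall_eq 0 fun c => LinearMap.congr_fun h3 c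

/-- Let C be the cokernel of Hom(K,Y) → Hom(K,M). Through the evaluations, surjectivity of φ makes K
⊗ Hom(K,Y) → K ⊗ Hom(K,M) onto, so K ⊗ C = 0 and hence C = 0. -/
lemma hom_surjective {Y M : ModuleCat.{u} R} [Module.Finite R M] (φ : Y →ₗ[R] M)
    (hφ : Function.Surjective φ) (hY : Function.Surjective (evK K Y))
    (hM : Function.Injective (evK K M)) (c : K →ₗ[R] M) : ∃ b : K →ₗ[R] Y, φ ∘ₗ b = c := by
  have := hK.finite
  let A := φ.compRight (M := K) R
  have h0 : Subsingleton (K ⊗[R] ((K →ₗ[R] M) ⧸ LinearMap.range A)) := by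
    refine subsingleton_of_forall_eq 0 fun t => ?_
    obtain ⟨t, rfl⟩ := LinearMap.lTensor_surjective K (Submodule.mkQ_surjective _) t
    obtain ⟨y, hy⟩ := hφ (evK K M t)
    obtain ⟨s, rfl⟩ := hY y
    have : A.lTensor K s = t := hM (by rw [evK_naturality, hy])
    rw [← this, ← LinearMap.comp_apply, ← LinearMap.lTensor_comp, LinearMap.range_mkQ_comp]
    simp
  have h1 := hK.subsingleton_of_tensor _ h0
  rw [Submodule.Quotient.subsingleton_iff, LinearMap.range_eq_top] at h1
  exact h1 c

end IsSemidualizing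

/-! ### Vanishing of Ext below the grade -/

lemma smul_ext_eq_zero {W B : ModuleCat.{u} R} {x : R} (hx : ∀ w : W, x • w = 0) {i : ℕ}
    (e : Ext W B i) : x • e = 0 := by
  have : x • 𝟙 W = 0 := by
    ext w
    exact hx w
  rw [← Ext.mk₀_id_comp e, ← Ext.smul_comp, ← Ext.mk₀_smul, this, Ext.mk₀_zero, Ext.zero_comp]

lemma isSES_smul {B : ModuleCat.{u} R} {x : R} (hx : IsSMulRegular B x) :
    IsSES (A := B) (B := B) (C := ModuleCat.of R (QuotSMulTop x B)) (LinearMap.lsmul R B x)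
      (x • (⊤ : Submodule R B)).mkQ where
  inj := hx
  exact := LinearMap.exact_lsmul_mkQ_smul_top B x
  surj := Submodule.mkQ_surjective _

/-- A map from K into the x-torsion of B is killed by x, hence zero; by faithfulness of Hom(K,-) the
x-torsion vanishes. -/
lemma IsSemidualizing.isSMulRegular_of_homK [IsNoetherianRing R] {K : ModuleCat.{u} R}
    (hK : IsSemidualizing K) {B : ModuleCat.{u} R} [Module.Finite R B] {x : R}
    (hx : IsSMulRegular (K →ₗ[R] B) x) : IsSMulRegular B x := by
  have h1 : Subsingleton (K →ₗ[R] LinearMap.ker (LinearMap.lsmul R B x)) := by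
    refine subsingleton_of_forall_eq 0 fun f => ?_
    have h2 : (LinearMap.ker (LinearMap.lsmul R B x)).subtype ∘ₗ f = 0 := by
      refine hx ?_
      ext k
      change x • (f k : B) = (x • (0 : K →ₗ[R] B)) k
      rw [smul_zero]
      exact (f k).2
    ext k
    exact LinearMap.congr_fun h2 k
  have h2 := hK.subsingleton_of_hom _ h1
  have h3 := (LinearMap.ker_eq_bot (f := LinearMap.lsmul R B x)).1
    (Submodule.subsingleton_iff_eq_bot.1 h2)
  exact h3

/-- Vanishing of `Ext` below a given degree is detected by the annihilator, and passes from
`Hom(K, B)` to `B`. -/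
lemma IsSemidualizing.ext_eq_zero_of_lt [IsNoetherianRing R] {K : ModuleCat.{u} R}
    (hK : IsSemidualizing K) (N W : ModuleCat.{u} R) [Module.Finite R N]
    (hNW : ∀ x : R, (∀ y : N, x • y = 0) → ∀ w : W, x • w = 0) (n : ℕ) :
    ∀ (B : ModuleCat.{u} R) [Module.Finite R B] (_ : ∀ i, Subsingleton (Ext K B (i + 1)))
      (_ : ∀ i < n, Subsingleton (Ext N (homK K B) i)), ∀ i < n, Subsingleton (Ext W B i) := by
  induction n with
  | zero => intro B _ _ _ i hi; omega
  | succ n ih =>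
    intro B _ hB hN i hi
    have := hK.finite
    have hfin : Module.Finite R (K →ₗ[R] B) := inferInstance
    -- Hom(N, Hom(K,B)) = 0 provides x in ann N regular on Hom(K,B), hence on B. The induction then
    -- passes to B/xB, which loses one degree of vanishing.
    obtain ⟨x, hx, hreg⟩ := IsSMulRegular.subsingleton_linearMap_iff.1
      (ext_zero_subsingleton_iff.1 (hN 0 n.succ_pos))
    rw [Module.mem_annihilator] at hx
    have hregB := hK.isSMulRegular_of_homK hreg
    have hs := isSES_smul hregB
    have hs' := hs.hom_co (X := K) (hs.lift_of_ext (hB 0))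
    have hfin' : Module.Finite R (QuotSMulTop x B) := inferInstance
    have hW := ih (ModuleCat.of R (QuotSMulTop x B))
      (fun j => hs.ext_right_of_mid (hB j) (hB (j + 1)))
      (fun j hj => hs'.ext_right_of_mid (hN j (by omega)) (hN (j + 1) (by omega)))
    rcases i with _ | j
    · rw [ext_zero_subsingleton_iff]
      refine subsingleton_of_forall_eq 0 fun f => ?_
      ext w
      refine hregB ?_
      simp only [LinearMap.zero_apply, smul_zero]
      rw [← map_smul, hNW x hx, map_zero]
    · refine subsingleton_of_forall_eq 0 fun e => ?_
      -- Since x kills W it kills Ext^{j+1}(W,B), so e is the boundary of a class in Ext^j(W,B/xB),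
      -- which is zero by induction.
      have he : e.comp (Ext.mk₀ (ModuleCat.smulShortComplex B x).f) (add_zero (j + 1)) = 0 := by
        have := Ext.smul_eq_comp_mk₀ e x
        rw [smul_ext_eq_zero (hNW x hx) e] at this
        exact this.symm
      obtain ⟨y, rfl⟩ := Ext.covariant_sequence_exact₁ W hs.shortExact e he rfl
      have := hW j (by omega)
      rw [Subsingleton.elim (α := Ext W (ModuleCat.of R (QuotSMulTop x B)) j) y 0, Ext.zero_comp]

lemma ext_subsingleton_of_lt_grade {N : ModuleCat.{u} R} {n : ℕ} (h : grade N = n) {i : ℕ}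
    (hi : i < n) : Subsingleton (Ext N (ModuleCat.of R R) i) := by
  by_contra hc
  rw [not_subsingleton_iff_nontrivial] at hc
  have : grade N ≤ i := iInf₂_le i hc
  rw [h] at this
  exact absurd (Nat.cast_le.1 this) (by omega)

/-- Below the grade of `N`, all `Ext^i(W, K)` vanish for `W` annihilated by `ann N`. -/
lemma IsSemidualizing.ext_eq_zero_of_lt_grade [IsNoetherianRing R] {K : ModuleCat.{u} R}
    (hK : IsSemidualizing K) {N W : ModuleCat.{u} R} [Module.Finite R N] {n : ℕ}
    (hn : grade N = n) (hNW : ∀ x : R, (∀ y : N, x • y = 0) → ∀ w : W, x • w = 0) {i : ℕ}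
    (hi : i < n) : Subsingleton (Ext W K i) := by
  have := hK.finite
  -- Here B = K: since Hom(K,K) ≅ R, the required vanishing on N is exactly the grade hypothesis.
  exact hK.ext_eq_zero_of_lt N W hNW n K (fun i => hK.ext_eq_zero _ i.succ_pos)
    (fun i hi => ext_subsingleton_of_equiv_right (Y := ModuleCat.of R R) hK.homothety.symm
      (ext_subsingleton_of_lt_grade hn hi)) i hi

end Semidualizing

/-! ### Syzygy constructions and dimension with respect to a class -/

section Dimension

variable {R : Type u} [CommRing R]

namespace IsSES

variable {A B C : ModuleCat.{u} R} {f : A →ₗ[R] B} {g : B →ₗ[R] C} (h : IsSES f g)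
include h

lemma comp_equiv_left {A' : ModuleCat.{u} R} (e : A' ≃ₗ[R] A) : IsSES (f ∘ₗ e.toLinearMap) g where
  inj := h.inj.comp e.injective
  exact := by
    intro b
    rw [h.exact b]
    constructor
    · rintro ⟨a, rfl⟩
      exact ⟨e.symm a, by simp⟩
    · rintro ⟨a, rfl⟩
      exact ⟨e a, rfl⟩
  surj := h.surj

lemma comp_equiv_right {C' : ModuleCat.{u} R} (e : C ≃ₗ[R] C') :
    IsSES f (e.toLinearMap ∘ₗ g) where
  inj := h.inj
  exact := by
    intro b
    rw [← h.exact b]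
    exact e.map_eq_zero_iff
  surj := e.surjective.comp h.surj

end IsSES

lemma isSES_ker {B C : ModuleCat.{u} R} (g : B →ₗ[R] C) (hg : Function.Surjective g) :
    IsSES (A := ModuleCat.of R (LinearMap.ker g)) (LinearMap.ker g).subtype g where
  inj := Subtype.val_injective
  exact := LinearMap.exact_subtype_ker_map g
  surj := hg

lemma isSES_zero_id (B : ModuleCat.{u} R) :
    IsSES (A := ModuleCat.of R PUnit.{u + 1}) (B := B) (C := B) 0 LinearMap.id where
  inj := Function.injective_of_subsingleton _
  exact := by
    intro b
    constructor
    · intro hb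
      exact ⟨0, hb.symm⟩
    · rintro ⟨a, rfl⟩
      rfl
  surj := Function.surjective_id

lemma isSES_inl_snd (A B : ModuleCat.{u} R) :
    IsSES (A := A) (B := ModuleCat.of R (A × B)) (C := B)
      (LinearMap.inl R A B) (LinearMap.snd R A B) where
  inj := LinearMap.inl_injective
  exact := Function.Exact.inl_snd
  surj := LinearMap.snd_surjective

/-- The kernel of `P → B → C` is an extension of `ker (B → C)` by `ker (P → B)`. -/
lemma IsSES.ker_comp {A B C D P : ModuleCat.{u} R} {f : A →ₗ[R] B} {g : B →ₗ[R] C}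
    {k : D →ₗ[R] P} {p : P →ₗ[R] B} (h : IsSES f g) (h' : IsSES k p) :
    ∃ (i : D →ₗ[R] ModuleCat.of R (LinearMap.ker (g ∘ₗ p)))
      (q : ModuleCat.of R (LinearMap.ker (g ∘ₗ p)) →ₗ[R] A), IsSES i q := by
  obtain ⟨q, hq⟩ := h.exists_factor (X := ModuleCat.of R (LinearMap.ker (g ∘ₗ p)))
    (p ∘ₗ (LinearMap.ker (g ∘ₗ p)).subtype) (LinearMap.ext fun x => x.2)
  replace hq := fun x => LinearMap.congr_fun hq x
  simp only [LinearMap.comp_apply] at hq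
  have hk : ∀ d, k d ∈ LinearMap.ker (g ∘ₗ p) := fun d => by
    rw [LinearMap.mem_ker, LinearMap.comp_apply, h'.exact.apply_apply_eq_zero, map_zero]
  refine ⟨k.codRestrict _ hk, q, ?_, ?_, ?_⟩
  · intro a b hab
    exact h'.inj (congrArg Subtype.val hab)
  · intro x
    rw [← h.inj.eq_iff, hq, map_zero]
    change p x.1 = 0 ↔ _
    rw [h'.exact x.1]
    constructor
    · rintro ⟨d, hd⟩
      exact ⟨d, Subtype.ext hd⟩
    · rintro ⟨d, rfl⟩
      exact ⟨d, rfl⟩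
  · intro a
    obtain ⟨x, hx⟩ := h'.surj (f a)
    refine ⟨⟨x, ?_⟩, h.inj ?_⟩
    · rw [LinearMap.mem_ker, LinearMap.comp_apply, hx, h.exact.apply_apply_eq_zero]
    · rw [hq]
      exact hx

/-- The horseshoe lemma. -/
lemma IsSES.horseshoe {A E B A' X B' P : ModuleCat.{u} R} {f : A →ₗ[R] E} {g : E →ₗ[R] B}
    {a : A' →ₗ[R] X} {α : X →ₗ[R] A} {b : B' →ₗ[R] P} {β : P →ₗ[R] B} [Module.Projective R P]
    (h : IsSES f g) (ha : IsSES a α) (hb : IsSES b β) :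
    ∃ (E' : ModuleCat.{u} R) (i : A' →ₗ[R] E') (q : E' →ₗ[R] B')
      (s : E' →ₗ[R] ModuleCat.of R (X × P)) (t : ModuleCat.of R (X × P) →ₗ[R] E),
      IsSES i q ∧ IsSES s t := by
  obtain ⟨l, hl⟩ := Module.projective_lifting_property g β h.surj
  have hl' : ∀ p, g (l p) = β p := fun p => LinearMap.congr_fun hl p
  let t : (X × P) →ₗ[R] E := (f ∘ₗ α).coprod l
  have ht : ∀ x p, t (x, p) = f (α x) + l p := fun x p => rfl
  have hgt : ∀ z, g (t z) = β z.2 := by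
    rintro ⟨x, p⟩
    rw [ht, map_add, h.exact.apply_apply_eq_zero, hl', zero_add]
  have hts : Function.Surjective t := by
    intro e
    obtain ⟨p, hp⟩ := hb.surj (g e)
    obtain ⟨y, hy⟩ := (h.exact (e - l p)).1 (by rw [map_sub, hl', hp, sub_self])
    obtain ⟨x, rfl⟩ := ha.surj y
    exact ⟨(x, p), by rw [ht, hy, sub_add_cancel]⟩
  obtain ⟨q, hq⟩ := hb.exists_factor (X := ModuleCat.of R (LinearMap.ker t))
    (LinearMap.snd R X P ∘ₗ (LinearMap.ker t).subtype) (LinearMap.ext fun z => by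
      change β z.1.2 = 0
      rw [← hgt, z.2, map_zero])
  replace hq := fun x => LinearMap.congr_fun hq x
  simp only [LinearMap.comp_apply] at hq
  have hi : ∀ y, (LinearMap.inl R X P ∘ₗ a) y ∈ LinearMap.ker t := fun y => by
    rw [LinearMap.mem_ker]
    change t (a y, 0) = 0
    rw [ht, ha.exact.apply_apply_eq_zero, map_zero, map_zero, add_zero]
  refine ⟨ModuleCat.of R (LinearMap.ker t), (LinearMap.inl R X P ∘ₗ a).codRestrict _ hi, q,
    (LinearMap.ker t).subtype, t, ⟨?_, ?_, ?_⟩, isSES_ker _ hts⟩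
  · intro x y hxy
    exact ha.inj (congrArg (fun z => z.1.1) hxy)
  · rintro ⟨⟨x, p⟩, hz⟩
    rw [← hb.inj.eq_iff, hq, map_zero]
    change p = 0 ↔ _
    constructor
    · rintro rfl
      rw [LinearMap.mem_ker, ht, map_zero, add_zero, map_eq_zero_iff f h.inj] at hz
      obtain ⟨y, rfl⟩ := (ha.exact x).1 hz
      exact ⟨y, rfl⟩
    · rintro ⟨y, hy⟩
      exact (congrArg (fun z => z.1.2) hy).symm
  · intro y
    obtain ⟨w, hw⟩ := (h.exact (l (b y))).1 (by rw [hl', hb.exact.apply_apply_eq_zero])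
    obtain ⟨x, rfl⟩ := ha.surj w
    refine ⟨⟨(-x, b y), ?_⟩, hb.inj ?_⟩
    · rw [LinearMap.mem_ker, ht, map_neg, map_neg, hw, neg_add_cancel]
    · rw [hq]
      rfl

/-- The pullback of `E → B ← P`. -/
lemma IsSES.exists_pullback {L E B B' P : ModuleCat.{u} R} {f : L →ₗ[R] E} {g : E →ₗ[R] B}
    {b : B' →ₗ[R] P} {β : P →ₗ[R] B} (h : IsSES f g) (hb : IsSES b β) :
    ∃ (G : ModuleCat.{u} R) (i : B' →ₗ[R] G) (q : G →ₗ[R] E) (j : L →ₗ[R] G) (r : G →ₗ[R] P),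
      IsSES i q ∧ IsSES j r := by
  let t : (E × P) →ₗ[R] B := g.coprod (-β)
  have ht : ∀ e p, t (e, p) = 0 ↔ g e = β p := fun e p => by
    change g e + -(β p) = 0 ↔ _
    rw [← sub_eq_add_neg, sub_eq_zero]
  have hi : ∀ y, (LinearMap.inr R E P ∘ₗ b) y ∈ LinearMap.ker t := fun y =>
    (ht 0 (b y)).2 (by rw [hb.exact.apply_apply_eq_zero, map_zero])
  have hj : ∀ y, (LinearMap.inl R E P ∘ₗ f) y ∈ LinearMap.ker t := fun y =>
    (ht (f y) 0).2 (by rw [h.exact.apply_apply_eq_zero, map_zero])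
  refine ⟨ModuleCat.of R (LinearMap.ker t), (LinearMap.inr R E P ∘ₗ b).codRestrict _ hi,
    LinearMap.fst R E P ∘ₗ (LinearMap.ker t).subtype,
    (LinearMap.inl R E P ∘ₗ f).codRestrict _ hj,
    LinearMap.snd R E P ∘ₗ (LinearMap.ker t).subtype, ⟨?_, ?_, ?_⟩, ⟨?_, ?_, ?_⟩⟩
  · intro x y hxy
    exact hb.inj (congrArg (fun z => z.1.2) hxy)
  · rintro ⟨⟨e, p⟩, hz⟩
    change e = 0 ↔ _
    constructor
    · rintro rfl
      have h1 := (ht _ _).1 hz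
      rw [map_zero] at h1
      obtain ⟨y, rfl⟩ := (hb.exact p).1 h1.symm
      exact ⟨y, rfl⟩
    · rintro ⟨y, hy⟩
      exact (congrArg (fun z => z.1.1) hy).symm
  · intro e
    obtain ⟨p, hp⟩ := hb.surj (g e)
    exact ⟨⟨(e, p), (ht e p).2 hp.symm⟩, rfl⟩
  · intro x y hxy
    exact h.inj (congrArg (fun z => z.1.1) hxy)
  · rintro ⟨⟨e, p⟩, hz⟩
    change p = 0 ↔ _
    constructor
    · rintro rfl
      have h1 := (ht _ _).1 hz
      rw [map_zero] at h1
      obtain ⟨y, rfl⟩ := (h.exact e).1 h1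
      exact ⟨y, rfl⟩
    · rintro ⟨y, hy⟩
      exact (congrArg (fun z => z.1.2) hy).symm
  · intro p
    obtain ⟨e, he⟩ := h.surj (β p)
    exact ⟨⟨(e, p), (ht e p).2 he⟩, rfl⟩

/-- `V` has a resolution of length at most `n` by modules in `C`. -/
def DimLE (C : ModuleCat.{u} R → Prop) : ℕ → ModuleCat.{u} R → Prop
  | 0, V => C V
  | n + 1, V => ∃ (V' X : ModuleCat.{u} R) (f : V' →ₗ[R] X) (g : X →ₗ[R] V),
      IsSES f g ∧ C X ∧ DimLE C n V'

lemma DimLE.of_equiv {C : ModuleCat.{u} R → Prop}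
    (hC : ∀ {X X' : ModuleCat.{u} R}, C X → (X' ≃ₗ[R] X) → C X') {n : ℕ}
    {V V' : ModuleCat.{u} R} (h : DimLE C n V) (e : V' ≃ₗ[R] V) : DimLE C n V' := by
  cases n with
  | zero => exact hC h e
  | succ n =>
    obtain ⟨W, X, f, g, hs, hX, hW⟩ := h
    exact ⟨W, X, f, _, hs.comp_equiv_right e.symm, hX, hW⟩

lemma DimLE.mono {C C' : ModuleCat.{u} R → Prop} (hC : ∀ X, C X → C' X) {n : ℕ} :
    ∀ {V : ModuleCat.{u} R}, DimLE C n V → DimLE C' n V := by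
  induction n with
  | zero => exact fun h => hC _ h
  | succ n ih =>
    rintro V ⟨W, X, f, g, hs, hX, hW⟩
    exact ⟨W, X, f, g, hs, hC _ hX, ih hW⟩

/-- A resolving class of finitely generated modules. -/
structure IsResolving (C : ModuleCat.{u} R → Prop) : Prop where
  finite : ∀ {V}, C V → Module.Finite R V
  projective : ∀ (P : ModuleCat.{u} R) [Module.Finite R P] [Module.Projective R P], C P
  extension : ∀ {A B D : ModuleCat.{u} R} {f : A →ₗ[R] B} {g : B →ₗ[R] D},
    IsSES f g → C A → C D → C B
  kernel : ∀ {A B D : ModuleCat.{u} R} {f : A →ₗ[R] B} {g : B →ₗ[R] D},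
    IsSES f g → C B → C D → C A

/-! ### Dimension in short exact sequences over a resolving class -/

namespace IsResolving

variable {C : ModuleCat.{u} R → Prop} (hC : IsResolving C)
include hC

lemma zero : C (ModuleCat.of R PUnit.{u + 1}) := hC.projective _

lemma dimLE_of_mem (n : ℕ) : ∀ {V : ModuleCat.{u} R}, C V → DimLE C n V := by
  induction n with
  | zero => exact fun h => h
  | succ n ih => exact fun {V} h => ⟨_, V, _, _, isSES_zero_id V, h, ih hC.zero⟩

lemma dimLE_succ {n : ℕ} : ∀ {V : ModuleCat.{u} R}, DimLE C n V → DimLE C (n + 1) V := by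
  induction n with
  | zero => exact fun h => hC.dimLE_of_mem 1 h
  | succ n ih =>
    rintro V ⟨W, X, f, g, hs, hX, hW⟩
    exact ⟨W, X, f, g, hs, hX, ih hW⟩

lemma prod {A B : ModuleCat.{u} R} (hA : C A) (hB : C B) : C (ModuleCat.of R (A × B)) :=
  hC.extension (isSES_inl_snd A B) hA hB

lemma dimLE_extension (n : ℕ) : ∀ {A E B : ModuleCat.{u} R} {f : A →ₗ[R] E} {g : E →ₗ[R] B},
    IsSES f g → DimLE C n A → DimLE C n B → DimLE C n E := by
  induction n with
  | zero => exact fun h hA hB => hC.extension h hA hB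
  | succ n ih =>
    rintro A E B f g h ⟨A', X, a, α, ha, hX, hA'⟩ ⟨B', Y, b, β, hb, hY, hB'⟩
    have := hC.finite hY
    -- The horseshoe lemma needs a projective over B, so Y is replaced by a free cover P. The new
    -- syzygy ker(P → B) is an extension of B' by ker(P → Y), which lies in C, so induction bounds
    -- its dimension.
    obtain ⟨m, p, hp⟩ := Module.Finite.exists_fin' R Y
    let P : ModuleCat.{u} R := ModuleCat.of R (Fin m → R)
    have hP := isSES_ker (B := P) p hp
    have hPC : C P := by
      have : Module.Finite R P := inferInstanceAs (Module.Finite R (Fin m → R))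
      have : Module.Projective R P := inferInstanceAs (Module.Projective R (Fin m → R))
      exact hC.projective P
    have : Module.Projective R P := inferInstanceAs (Module.Projective R (Fin m → R))
    obtain ⟨i, q, hiq⟩ := hb.ker_comp hP
    have hB'' := ih hiq (hC.dimLE_of_mem n (hC.kernel hP hPC hY)) hB'
    obtain ⟨E', i', q', s, t, h1, h2⟩ :=
      h.horseshoe ha (isSES_ker (B := P) (β ∘ₗ p) (hb.surj.comp hp))
    exact ⟨E', _, s, t, h2, hC.prod hX hPC, ih h1 hA' hB''⟩

lemma dimLE_kernel (n : ℕ) {L E B : ModuleCat.{u} R} {f : L →ₗ[R] E} {g : E →ₗ[R] B}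
    (h : IsSES f g) (hE : DimLE C n E) (hB : DimLE C n B) : DimLE C n L := by
  cases n with
  | zero => exact hC.kernel h hE hB
  | succ n =>
    obtain ⟨B', P, b, β, hb, hP, hB'⟩ := hB
    -- The pullback G is an extension of E by B', and also of P by L. For X → G with X in C and
    -- kernel G', the kernel of X → G → P lies in C and maps onto L with kernel G'.
    obtain ⟨G, i, q, j, r, h1, h2⟩ := h.exists_pullback hb
    obtain ⟨G', X, c, γ, hc, hX, hG'⟩ :=
      hC.dimLE_extension (n + 1) h1 (hC.dimLE_succ hB') hE
    obtain ⟨i', q', h3⟩ := h2.ker_comp hc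
    exact ⟨G', _, i', q', h3, hC.kernel (isSES_ker (r ∘ₗ γ) (h2.surj.comp hc.surj)) hX hP, hG'⟩

end IsResolving

/-- The duality `Hom(-, K)` and the functor `Hom(K, -)` relate the classes `C` and `D`. -/
structure IsDualPair (K : ModuleCat.{u} R) (C D : ModuleCat.{u} R → Prop) : Prop where
  resolving : IsResolving C
  ext_left : ∀ {V}, C V → ∀ i, Subsingleton (Ext V K (i + 1))
  dual : ∀ {V}, C V → D (homK V K)
  equiv : ∀ {X X' : ModuleCat.{u} R}, D X → (X' ≃ₗ[R] X) → D X'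
  ext_right : ∀ {X}, D X → ∀ i, Subsingleton (Ext K X (i + 1))
  bijective_evK : ∀ {X}, D X → Function.Bijective (evK K X)
  homK_mem : ∀ {X}, D X → C (homK K X)
  ext_of_ext : ∀ {X}, D X → ∀ (N : ModuleCat.{u} R) (n : ℕ),
    (∀ i < n, Subsingleton (Ext N K i)) → ∀ i < n, Subsingleton (Ext N X i)

/-- A four-lemma chase between the sequence and its image under K ⊗ Hom(K,-), where the lifting
hypothesis makes K ⊗ Hom(K,X) → K ⊗ Hom(K,Z) onto. -/
lemma IsSES.evK_bijective {K Z' X Z : ModuleCat.{u} R} {f : Z' →ₗ[R] X} {g : X →ₗ[R] Z}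
    (h : IsSES f g) (H : ∀ c : K →ₗ[R] Z, ∃ b : K →ₗ[R] X, g ∘ₗ b = c)
    (hZ' : Function.Surjective (evK K Z')) (hX : Function.Bijective (evK K X)) :
    Function.Bijective (evK K Z) := by
  have hA := h.hom_co H
  constructor
  · rw [injective_iff_map_eq_zero]
    intro t ht
    obtain ⟨s, rfl⟩ := LinearMap.lTensor_surjective K hA.surj t
    rw [evK_naturality] at ht
    obtain ⟨z, hz⟩ := (h.exact _).1 ht
    obtain ⟨w, rfl⟩ := hZ' z
    rw [← evK_naturality] at hz
    rw [← hX.1 hz, ← LinearMap.comp_apply, ← LinearMap.lTensor_comp]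
    have : g.compRight (M := K) R ∘ₗ f.compRight R = 0 := hA.comp_eq_zero
    rw [this, LinearMap.lTensor_zero, LinearMap.zero_apply]
  · intro z
    obtain ⟨x, rfl⟩ := h.surj z
    obtain ⟨t, rfl⟩ := hX.2 x
    exact ⟨_, evK_naturality K g t⟩

/-! ### Transport of resolutions through a dual pair -/

namespace IsDualPair

variable {K : ModuleCat.{u} R} {C D : ModuleCat.{u} R → Prop} (h : IsDualPair K C D)
include h

lemma zero_mem : D (ModuleCat.of R PUnit.{u + 1}) := by
  have : Subsingleton (ModuleCat.of R PUnit.{u + 1} →ₗ[R] K) :=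
    inferInstanceAs (Subsingleton (PUnit.{u + 1} →ₗ[R] K))
  exact h.equiv (h.dual h.resolving.zero)
    { toFun := 0, invFun := 0, map_add' := by simp, map_smul' := by simp,
      left_inv := fun _ => rfl, right_inv := fun _ => Subsingleton.elim _ _ }

lemma dimLE_ext_left {n : ℕ} : ∀ {V : ModuleCat.{u} R}, DimLE C n V →
    ∀ i, Subsingleton (Ext V K (n + i + 1)) := by
  induction n with
  | zero =>
    intro V hV i
    rw [zero_add]
    exact h.ext_left hV i
  | succ n ih =>
    rintro V ⟨W, X, f, g, hs, hX, hW⟩ i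
    rw [show n + 1 + i + 1 = n + i + 1 + 1 by omega]
    exact hs.ext_right_of_mid' (h.ext_left hX _) (ih hW i)

/-- The three assertions are proved together: Ext^1(K,W) = 0 for the syzygy W keeps the sequence
exact under Hom(K,-), and this carries both evaluation and resolution up to M. -/
lemma dimLE_homK {n : ℕ} : ∀ {M : ModuleCat.{u} R}, DimLE D n M →
    (∀ i, Subsingleton (Ext K M (i + 1))) ∧ Function.Bijective (evK K M) ∧
      DimLE C n (homK K M) := by
  induction n with
  | zero => exact fun hM => ⟨h.ext_right hM, h.bijective_evK hM, h.homK_mem hM⟩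
  | succ n ih =>
    rintro M ⟨W, X, f, g, hs, hX, hW⟩
    obtain ⟨h1, h2, h3⟩ := ih hW
    have hl := fun c : K →ₗ[R] M => hs.lift_of_ext (h1 0) c
    exact ⟨fun i => hs.ext_right_of_mid (h.ext_right hX i) (h1 (i + 1)),
      hs.evK_bijective hl h2.2 (h.bijective_evK hX), _, _, _, _, hs.hom_co hl, h.homK_mem hX, h3⟩

/-- Each syzygy step costs one degree of vanishing. For Z = N and i = 0 this gives Hom(N,N) = 0,
which is why the D-dimension cannot be smaller than the grade. -/
lemma ext_of_dimLE {N : ModuleCat.{u} R} {n : ℕ} (hN : ∀ i < n, Subsingleton (Ext N K i))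
    {m : ℕ} : ∀ {Z : ModuleCat.{u} R}, DimLE D m Z → ∀ i, i + m < n →
      Subsingleton (Ext N Z i) := by
  induction m with
  | zero => exact fun hZ i hi => h.ext_of_ext hZ N n hN i hi
  | succ m ih =>
    rintro Z ⟨W, X, f, g, hs, hX, hW⟩ i hi
    exact hs.ext_right_of_mid (h.ext_of_ext hX N n hN i (by omega)) (ih hW (i + 1) (by omega))

lemma subsingleton_of_dimLE {N : ModuleCat.{u} R} {n m : ℕ}
    (hN : ∀ i < n, Subsingleton (Ext N K i)) (hm : DimLE D m N) (hmn : m < n) :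
    Subsingleton N := by
  have := ext_zero_subsingleton_iff.1 (h.ext_of_dimLE hN hm 0 (by omega))
  exact subsingleton_of_forall_eq 0 fun x =>
    LinearMap.congr_fun (Subsingleton.elim (LinearMap.id : N →ₗ[R] N) 0) x

/-- The dual of a resolution of L is resolved from the left: I is the image of Hom(X,K) in
Hom(L',K), with a D-resolution of length m already built. When Ext^1(L,K) = 0, I is all of
Hom(L',K), so the next image has a resolution longer by one, and the degree shifts from L to L'. At
the last stage Ext^1(L,K) = Hom(L',K)/I. -/
lemma dimLE_ext_succ (n : ℕ) : ∀ {L' X L : ModuleCat.{u} R} {f : L' →ₗ[R] X} {g : X →ₗ[R] L},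
    IsSES f g → C X → DimLE C n L' → (∀ i < n, Subsingleton (Ext L K (i + 1))) →
    ∀ (m : ℕ) (I : ModuleCat.{u} R), (I ≃ₗ[R] LinearMap.range (f.lcomp R K)) → DimLE D m I →
      DimLE D (m + 1 + n) (ModuleCat.of R (Ext L K (n + 1))) := by
  induction n with
  | zero =>
    intro L' X L f g hs hX hL' _ m I e hI
    refine ⟨I, homK L' K, (LinearMap.range (f.lcomp R K)).subtype ∘ₗ e.toLinearMap,
      hs.deltaHom K, IsSES.comp_equiv_left (A := ModuleCat.of R (LinearMap.range (f.lcomp R K)))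
        (C := ModuleCat.of R (Ext L K 1)) ⟨Subtype.val_injective, ?_,
          hs.deltaHom_surjective (h.ext_left hX 0)⟩ e, h.dual hL', hI⟩
    intro x
    rw [hs.exact_deltaHom K x]
    simp
  | succ n ih =>
    rintro L' X L f g hs hX ⟨L'', X', f', g', hs', hX', hL''⟩ hL m I e hI
    have htop : LinearMap.range (f.lcomp R K) = ⊤ :=
      LinearMap.range_eq_top.2 (hs.extend_of_ext (hL 0 n.succ_pos))
    let e' : I ≃ₗ[R] homK L' K := e.trans (LinearEquiv.ofTop _ htop)
    have hI' : DimLE D (m + 1) (ModuleCat.of R (LinearMap.range (f'.lcomp R K))) := by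
      refine ⟨I, homK X' K, (g'.lcomp R K) ∘ₗ e'.toLinearMap,
        (f'.lcomp R K).rangeRestrict, IsSES.comp_equiv_left (A := homK L' K)
          ⟨?_, ?_, LinearMap.surjective_rangeRestrict _⟩ e', h.dual hX', hI⟩
      · intro a b hab
        ext x
        obtain ⟨y, rfl⟩ := hs'.surj x
        exact LinearMap.congr_fun hab y
      · intro b
        rw [Subtype.ext_iff]
        change b ∘ₗ f' = 0 ↔ _
        constructor
        · intro hb
          exact hs'.exists_desc b hb
        · rintro ⟨c, rfl⟩
          ext x
          change c (g' (f' x)) = 0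
          rw [hs'.exact.apply_apply_eq_zero, map_zero]
    have key := ih hs' hX' hL'' (fun i hi => hs.ext_left_of_mid' (h.ext_left hX i)
      (hL (i + 1) (by omega))) (m + 1) _ (LinearEquiv.refl R _) hI'
    rw [show m + 1 + 1 + n = m + 1 + (n + 1) by omega] at key
    exact key.of_equiv h.equiv (V' := ModuleCat.of R (Ext L K (n + 1 + 1)))
      (LinearEquiv.ofBijective (hs.delta K (n + 1))
        (hs.delta_bijective (h.ext_left hX n) (h.ext_left hX (n + 1)))).symm

/-- If `Ext^i(L, K)` vanishes for `i < n`, a `C`-resolution of `L` of length `n` dualizes to a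
`D`-resolution of `Ext^n(L, K)`. -/
lemma dimLE_ext {n : ℕ} {L : ModuleCat.{u} R} (hL : DimLE C n L)
    (hext : ∀ i < n, Subsingleton (Ext L K i)) :
    DimLE D n (ModuleCat.of R (Ext L K n)) := by
  cases n with
  | zero =>
    exact h.equiv (h.dual hL) ((Ext.linearEquiv₀ (R := R)).trans
      (ModuleCat.homLinearEquiv (S := R)))
  | succ n =>
    obtain ⟨L', X, f, g, hs, hX, hL'⟩ := hL
    -- Hom(L,K) = 0 makes Hom(X,K) → Hom(L',K) injective, so the first image is Hom(X,K) itself, in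
    -- D, and m = 0.
    have h0 := ext_zero_subsingleton_iff.1 (hext 0 n.succ_pos)
    have hinj : Function.Injective (f.lcomp R K) := by
      rw [injective_iff_map_eq_zero]
      intro b hb
      obtain ⟨c, rfl⟩ := hs.exists_desc b hb
      rw [Subsingleton.elim c 0, LinearMap.zero_comp]
    have := h.dimLE_ext_succ n hs hX hL' (fun i hi => hext (i + 1) (by omega)) 0
      (homK X K) (LinearEquiv.ofInjective _ hinj) (h.dual hX)
    rwa [show 0 + 1 + n = n + 1 by omega] at this

end IsDualPair

end Dimension

/-! ### Perfection as a bound on the dimension, and its passage through colinkage -/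

section Perfect

variable {R : Type u} [CommRing R]

lemma Resolution.length_le_iff {C : ModuleCat.{u} R → Prop} {M : ModuleCat.{u} R}
    (P : Resolution C M) (n : ℕ) :
    P.length ≤ ((n : ℕ∞) : WithBot ℕ∞) ↔ ∀ i, n < i → Subsingleton (P.X i) := by
  rw [Resolution.length, iSup₂_le_iff]
  refine forall_congr' fun i => ?_
  rw [WithBot.coe_le_coe, Nat.cast_le, ← not_lt, ← not_subsingleton_iff_nontrivial, not_imp_not]

lemma dimLE_of_resolution {C : ModuleCat.{u} R → Prop}
    (hC : ∀ {X X' : ModuleCat.{u} R}, C X → (X' ≃ₗ[R] X) → C X') (n : ℕ) :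
    ∀ {M : ModuleCat.{u} R} (P : Resolution C M), (∀ i, n < i → Subsingleton (P.X i)) →
      DimLE C n M := by
  induction n with
  | zero =>
    intro M P hP
    have h1 := hP 1 one_pos
    refine hC (P.mem 0) (LinearEquiv.ofBijective P.aug ⟨?_, P.aug_surjective⟩).symm
    rw [injective_iff_map_eq_zero]
    intro x hx
    obtain ⟨y, rfl⟩ := (P.exact_zero x).1 hx
    rw [Subsingleton.elim (α := P.X (0 + 1)) y 0, map_zero]
  | succ n ih =>
    intro M P hP
    refine ⟨_, P.X 0, _, _, isSES_ker P.aug P.aug_surjective, P.mem 0, ih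
      { X := fun i => P.X (i + 1)
        d := fun i => P.d (i + 1)
        aug := (P.d 0).codRestrict _ fun x => P.exact_zero.apply_apply_eq_zero x
        mem := fun i => P.mem (i + 1)
        aug_surjective := ?_
        exact_zero := ?_
        exact_succ := fun i => P.exact_succ (i + 1) } fun i hi => hP (i + 1) (by omega)⟩
    · rintro ⟨x, hx⟩
      obtain ⟨y, rfl⟩ := (P.exact_zero x).1 hx
      exact ⟨y, rfl⟩
    · intro x
      rw [Subtype.ext_iff]
      exact P.exact_succ 0 x

/-- The resolution obtained from a resolution of the kernel of `X → M`. -/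
def Resolution.cons {C : ModuleCat.{u} R → Prop} {M' X M : ModuleCat.{u} R} {f : M' →ₗ[R] X}
    {g : X →ₗ[R] M} (h : IsSES f g) (hX : C X) (P : Resolution C M') : Resolution C M where
  X i := Nat.casesOn i X P.X
  d i := match i with
    | 0 => f ∘ₗ P.aug
    | i + 1 => P.d i
  aug := g
  mem i := match i with
    | 0 => hX
    | i + 1 => P.mem i
  aug_surjective := h.surj
  exact_zero := by
    intro x
    rw [h.exact x]
    constructor
    · rintro ⟨y, rfl⟩
      obtain ⟨z, rfl⟩ := P.aug_surjective y
      exact ⟨z, rfl⟩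
    · rintro ⟨z, rfl⟩
      exact ⟨P.aug z, rfl⟩
  exact_succ i := match i with
    | 0 => fun x => by
      rw [← P.exact_zero x]
      exact map_eq_zero_iff f h.inj
    | i + 1 => P.exact_succ i

/-- A `Resolution` has a term in every degree, so a finite one is padded with zero modules, which
must belong to C. -/
lemma exists_resolution {C : ModuleCat.{u} R → Prop} (h0 : C (ModuleCat.of R PUnit.{u + 1}))
    (n : ℕ) : ∀ {M : ModuleCat.{u} R}, DimLE C n M →
      ∃ P : Resolution C M, ∀ i, n < i → Subsingleton (P.X i) := by
  induction n with
  | zero =>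
    intro M hM
    let P0 : Resolution C (ModuleCat.of R PUnit.{u + 1}) :=
      { X := fun _ => ModuleCat.of R PUnit.{u + 1}
        d := fun _ => 0
        aug := 0
        mem := fun _ => h0
        aug_surjective := fun x => ⟨0, rfl⟩
        exact_zero := fun x => ⟨fun _ => ⟨0, rfl⟩, fun _ => rfl⟩
        exact_succ := fun _ x => ⟨fun _ => ⟨0, rfl⟩, fun _ => rfl⟩ }
    refine ⟨P0.cons (isSES_zero_id M) hM, fun i hi => ?_⟩
    obtain ⟨j, rfl⟩ := Nat.exists_eq_add_of_lt hi
    rw [zero_add]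
    exact inferInstanceAs (Subsingleton PUnit.{u + 1})
  | succ n ih =>
    rintro M ⟨W, X, f, g, hs, hX, hW⟩
    obtain ⟨P, hP⟩ := ih hW
    refine ⟨P.cons hs hX, fun i hi => ?_⟩
    obtain ⟨j, rfl⟩ : ∃ j, i = j + 1 := ⟨i - 1, by omega⟩
    exact hP j (by omega)

lemma dimLE_of_resolutionDim_le {C : ModuleCat.{u} R → Prop}
    (hC : ∀ {X X' : ModuleCat.{u} R}, C X → (X' ≃ₗ[R] X) → C X') {n : ℕ} {M : ModuleCat.{u} R}
    (h : resolutionDim C M ≤ ((n : ℕ∞) : WithBot ℕ∞)) : DimLE C n M := by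
  -- The strict bound n + 1 extracts an actual resolution from the infimum; its length is then at
  -- most n.
  have h1 : resolutionDim C M < (((n + 1 : ℕ) : ℕ∞) : WithBot ℕ∞) :=
    h.trans_lt (WithBot.coe_lt_coe.2 (Nat.cast_lt.2 n.lt_succ_self))
  obtain ⟨P, hP⟩ := iInf_lt_iff.1 h1
  refine dimLE_of_resolution hC n P fun i hi => ?_
  by_contra hc
  rw [not_subsingleton_iff_nontrivial] at hc
  have h2 : ((i : ℕ∞) : WithBot ℕ∞) ≤ P.length :=
    le_iSup₂ (f := fun (i : ℕ) (_ : Nontrivial (P.X i)) => ((i : ℕ∞) : WithBot ℕ∞)) i hc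
  have h3 := Nat.cast_lt.1 (WithBot.coe_lt_coe.1 (h2.trans_lt hP))
  omega

lemma nontrivial_of_grade_eq {N : ModuleCat.{u} R} {n : ℕ} (h : grade N = n) : Nontrivial N := by
  by_contra hc
  rw [not_nontrivial_iff_subsingleton] at hc
  have h1 : grade N = ⊤ := by
    rw [grade, iInf₂_eq_top]
    intro i hi
    exfalso
    have h2 : 𝟙 N = 0 := by
      ext x
      exact Subsingleton.elim _ _
    refine not_subsingleton_iff_nontrivial.2 hi (subsingleton_of_forall_eq 0 fun e => ?_)
    rw [← Ext.mk₀_id_comp e, h2, Ext.mk₀_zero, Ext.zero_comp]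
  rw [h1] at h
  exact ENat.top_ne_natCast n h

variable [IsNoetherianRing R] {K : ModuleCat.{u} R} {C D : ModuleCat.{u} R → Prop}

/-- For a module of grade `n`, having a `D`-resolution of length at most `n` means that the
grade is the `D`-dimension. -/
lemma IsDualPair.grade_eq_iff (hK : IsSemidualizing K) (h : IsDualPair K C D)
    {N : ModuleCat.{u} R} [Module.Finite R N] {n : ℕ} (hn : grade N = n) :
    (grade N : WithBot ℕ∞) = resolutionDim D N ↔ DimLE D n N := by
  rw [hn]
  constructor
  · exact fun H => dimLE_of_resolutionDim_le h.equiv H.ge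
  intro H
  have hN := nontrivial_of_grade_eq hn
  have hext : ∀ i < n, Subsingleton (Ext N K i) := fun i hi =>
    hK.ext_eq_zero_of_lt_grade hn (fun x hx => hx) hi
  refine le_antisymm (le_iInf fun P => ?_) ?_
  -- For n = 0 the length could only fail the bound by being `⊥`, which is excluded because X₀
  -- surjects onto the nonzero module N.
  · cases n with
    | zero =>
      have : Nontrivial (P.X 0) := P.aug_surjective.nontrivial
      exact le_iSup₂ (f := fun (i : ℕ) (_ : Nontrivial (P.X i)) => ((i : ℕ∞) : WithBot ℕ∞)) 0 this
    | succ n =>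
      by_contra hc
      rw [not_le] at hc
      have h1 : ∀ i, n < i → Subsingleton (P.X i) := by
        intro i hi
        by_contra hc'
        rw [not_subsingleton_iff_nontrivial] at hc'
        have h2 : ((i : ℕ∞) : WithBot ℕ∞) ≤ P.length :=
          le_iSup₂ (f := fun (i : ℕ) (_ : Nontrivial (P.X i)) => ((i : ℕ∞) : WithBot ℕ∞)) i hc'
        have h3 := Nat.cast_lt.1 (WithBot.coe_lt_coe.1 (h2.trans_lt hc))
        omega
      exact not_subsingleton_iff_nontrivial.2 hN
        (h.subsingleton_of_dimLE hext (dimLE_of_resolution h.equiv n P h1) n.lt_succ_self)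
  · obtain ⟨P, hP⟩ := exists_resolution h.zero_mem n H
    exact (iInf_le _ P).trans ((P.length_le_iff n).2 hP)

/-- The target of `𝓛_K^n(φ)` has a `D`-resolution of length at most `n` if the target of `φ` has
one. -/
lemma IsDualPair.dimLE_colink (hK : IsSemidualizing K) (h : IsDualPair K C D)
    {Y M : ModuleCat.{u} R} [Module.Finite R Y] [Module.Finite R M] {n : ℕ} (φ : Y ⟶ M)
    (hφ : Function.Surjective φ) (hYn : grade Y = n) (hY : DimLE D n Y) (hM : DimLE D n M) :
    DimLE D n (ModuleCat.of R (LinearMap.range (dualMap K n (kerIncl φ)))) := by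
  obtain ⟨-, hY2, hY3⟩ := h.dimLE_homK hY
  obtain ⟨-, hM2, hM3⟩ := h.dimLE_homK hM
  have hs := (isSES_ker φ.hom hφ).hom_co (X := K) (hK.hom_surjective φ.hom hφ hY2.2 hM2.1)
  have hL := h.resolving.dimLE_kernel n hs hY3 hM3
  have hext : ∀ i < n, Subsingleton (Ext (homK K (ModuleCat.of R (LinearMap.ker φ.hom))) K i) := by
    intro i hi
    -- Maps into ker φ ⊆ Y are killed by ann Y, so the grade of Y controls this Ext.
    refine hK.ext_eq_zero_of_lt_grade hYn (fun x hx w => ?_) hi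
    ext k
    exact hx (w k).1
  have hsurj : Function.Surjective (dualMap K n (kerIncl φ)) := by
    intro x
    -- The obstruction to surjectivity lies in Ext^{n+1}(Hom(K,M),K), zero because Hom(K,M) has
    -- C-dimension at most n.
    have h0 := h.dimLE_ext_left hM3 0
    exact Ext.contravariant_sequence_exact₁ hs.shortExact K x (add_comm 1 n)
      (Subsingleton.elim (α := Ext (homK K M) K (n + 0 + 1)) _ _)
  exact (h.dimLE_ext hL hext).of_equiv h.equiv
    (LinearEquiv.ofTop _ (LinearMap.range_eq_top.2 hsurj))

end Perfect

/-! ### The dual pair of finitely generated projectives and P_K -/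

section Projective

variable {R : Type u} [CommRing R]

lemma IsSES.finite_mid [IsNoetherianRing R] {A B C : ModuleCat.{u} R} {f : A →ₗ[R] B}
    {g : B →ₗ[R] C} (h : IsSES f g) (hA : Module.Finite R A) (hC : Module.Finite R C) :
    Module.Finite R B := by
  have := isNoetherian_of_range_eq_ker f g (LinearMap.exact_iff.1 h.exact).symm
  infer_instance

lemma IsSES.finite_left [IsNoetherianRing R] {A B C : ModuleCat.{u} R} {f : A →ₗ[R] B}
    {g : B →ₗ[R] C} (h : IsSES f g) (hB : Module.Finite R B) : Module.Finite R A :=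
  Module.Finite.of_injective f h.inj

lemma projective_of_ext {P : ModuleCat.{u} R}
    (h : ∀ Y : ModuleCat.{u} R, Subsingleton (Ext P Y 1)) : Module.Projective R P :=
  (IsProjective.iff_projective (R := R) P).2 (projective_iff_subsingleton_ext_one.2 fun {Y} => h Y)

/-- Finitely generated projective modules. -/
def IsFGProjective (P : ModuleCat.{u} R) : Prop :=
  Module.Finite R P ∧ Module.Projective R P

lemma IsFGProjective.ext {P : ModuleCat.{u} R} (hP : IsFGProjective P) (Y : ModuleCat.{u} R)
    (i : ℕ) : Subsingleton (Ext P Y (i + 1)) := by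
  have := hP.2
  exact ext_subsingleton_of_projective P Y i

lemma IsFGProjective.isKProjective_dual {P : ModuleCat.{u} R} (hP : IsFGProjective P)
    (K : ModuleCat.{u} R) : IsKProjective K (homK P K) := by
  have := hP.1
  have := hP.2
  exact IsKProjective.dual P

lemma isKProjective_self (K : ModuleCat.{u} R) : IsKProjective K K :=
  ⟨ModuleCat.of R R, inferInstanceAs (Module.Finite R R), inferInstanceAs (Module.Projective R R),
    ⟨(TensorProduct.lid R K).symm⟩⟩

/-- A finitely generated projective module is a retract of a power of `R`. -/
lemma IsFGProjective.isSummandOfPower {P : ModuleCat.{u} R} (hP : IsFGProjective P) :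
    IsSummandOfPower P (ModuleCat.of R R) :=
  IsKProjective.isSummandOfPower ⟨P, hP.1, hP.2, ⟨(TensorProduct.rid R P).symm⟩⟩

lemma exists_cover (V : ModuleCat.{u} R) [Module.Finite R V] :
    ∃ (W P : ModuleCat.{u} R) (f : W →ₗ[R] P) (g : P →ₗ[R] V), IsSES f g ∧ IsFGProjective P := by
  obtain ⟨m, p, hp⟩ := Module.Finite.exists_fin' R V
  exact ⟨_, ModuleCat.of R (Fin m → R), _, _, isSES_ker (B := ModuleCat.of R (Fin m → R)) p hp,
    inferInstanceAs (Module.Finite R (Fin m → R)), inferInstanceAs (Module.Projective R (Fin m → R))⟩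

/-- P ⊗ K ≅ Hom(P*,K) with P* projective, hence in C. This lets the P_K-perfect source Y be used for
every D. -/
lemma IsDualPair.mem_of_isKProjective {K : ModuleCat.{u} R} {C D : ModuleCat.{u} R → Prop}
    (h : IsDualPair K C D) {X : ModuleCat.{u} R} (hX : IsKProjective K X) : D X := by
  obtain ⟨P, h1, h2, ⟨e⟩⟩ := hX
  let V : ModuleCat.{u} R := ModuleCat.of R (Module.Dual R P)
  have : Module.Finite R V := inferInstanceAs (Module.Finite R (Module.Dual R P))
  have : Module.Projective R V := inferInstanceAs (Module.Projective R (Module.Dual R P))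
  exact h.equiv (h.dual (h.resolving.projective V)) (e.trans
    ((TensorProduct.congr (Module.evalEquiv R P) (LinearEquiv.refl R K)).trans
      (dualTensorHomEquiv R V K)))

variable [IsNoetherianRing R]

lemma isResolving_fgProjective : IsResolving (R := R) IsFGProjective where
  finite h := h.1
  projective _ h1 h2 := ⟨h1, h2⟩
  extension h hA hD := ⟨h.finite_mid hA.1 hD.1,
    projective_of_ext fun Y => h.ext_mid' (hA.ext Y 0) (hD.ext Y 0)⟩
  kernel h hB hD := ⟨h.finite_left hB.1,
    projective_of_ext fun Y => h.ext_left_of_mid' (hB.ext Y 0) (hD.ext Y 1)⟩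

lemma IsSemidualizing.isDualPair_isKProjective {K : ModuleCat.{u} R} (hK : IsSemidualizing K) :
    IsDualPair K IsFGProjective (IsKProjective K) where
  resolving := isResolving_fgProjective
  ext_left hV i := hV.ext K i
  dual hV := hV.isKProjective_dual K
  equiv hX e := hX.of_equiv e
  ext_right hX i := hK.ext_K_eq_zero hX.isSummandOfPower i
  bijective_evK hX := hK.evK_bijective hX.isSummandOfPower
  homK_mem hX := hK.homK_finite_projective hX.isSummandOfPower
  ext_of_ext hX _ _ h i hi := hX.isSummandOfPower.ext_right (h i hi)

end Projective

/-! ### Totally reflexive modules and their K-duals -/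

section TotallyReflexive

variable {R : Type u} [CommRing R]

/-- The cokernel of `A → B → C`, for monomorphisms `A → B` and `B → C`. -/
lemma IsSES.comp_mono {L E B P E' : ModuleCat.{u} R} {f : L →ₗ[R] E} {g : E →ₗ[R] B}
    {i : E →ₗ[R] P} {c : P →ₗ[R] E'} (h : IsSES f g) (h' : IsSES i c) :
    ∃ (W : ModuleCat.{u} R) (q : P →ₗ[R] W) (j : B →ₗ[R] W) (r : W →ₗ[R] E'),
      IsSES (i ∘ₗ f) q ∧ IsSES j r := by
  let N := LinearMap.range (i ∘ₗ f)
  have hN : IsSES (C := ModuleCat.of R (P ⧸ N)) (i ∘ₗ f) N.mkQ :=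
    ⟨h'.inj.comp h.inj, LinearMap.exact_map_mkQ_range _, N.mkQ_surjective⟩
  obtain ⟨j, hj⟩ := h.exists_desc (Y := ModuleCat.of R (P ⧸ N)) (N.mkQ ∘ₗ i)
    (LinearMap.ext fun x => hN.exact.apply_apply_eq_zero x)
  obtain ⟨r, hr⟩ := hN.exists_desc c (LinearMap.ext fun x => h'.exact.apply_apply_eq_zero (f x))
  have hj' : ∀ e, j (g e) = N.mkQ (i e) := LinearMap.congr_fun hj
  have hr' : ∀ p, r (N.mkQ p) = c p := LinearMap.congr_fun hr
  refine ⟨_, N.mkQ, j, r, hN, ?_, ?_, ?_⟩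
  · rw [injective_iff_map_eq_zero]
    intro b hb
    obtain ⟨e, rfl⟩ := h.surj b
    rw [hj'] at hb
    obtain ⟨l, hl⟩ := (hN.exact _).1 hb
    rw [← h'.inj hl, h.exact.apply_apply_eq_zero]
  · intro w
    obtain ⟨p, rfl⟩ := hN.surj w
    rw [hr', h'.exact p]
    constructor
    · rintro ⟨e, rfl⟩
      exact ⟨g e, hj' e⟩
    · rintro ⟨b, hb⟩
      obtain ⟨e, rfl⟩ := h.surj b
      rw [hj'] at hb
      have h1 : N.mkQ (p - i e) = 0 := by rw [map_sub, hb, sub_self]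
      obtain ⟨l, hl⟩ := (hN.exact _).1 h1
      exact ⟨f l + e, by rw [map_add]; exact eq_add_of_sub_eq hl.symm ▸ rfl⟩
  · intro e
    obtain ⟨p, rfl⟩ := h'.surj e
    exact ⟨_, hr' p⟩

/-- The horseshoe lemma for embeddings. -/
lemma IsSES.cohorseshoe {A E B P A' Q B' : ModuleCat.{u} R} {f : A →ₗ[R] E} {g : E →ₗ[R] B}
    {a : A →ₗ[R] P} {α : P →ₗ[R] A'} {b : B →ₗ[R] Q} {β : Q →ₗ[R] B'}
    (h : IsSES f g) (ha : IsSES a α) (hb : IsSES b β) (l : E →ₗ[R] P) (hl : l ∘ₗ f = a) :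
    ∃ (E' : ModuleCat.{u} R) (s : E →ₗ[R] ModuleCat.of R (P × Q))
      (t : ModuleCat.of R (P × Q) →ₗ[R] E') (i : A' →ₗ[R] E') (q : E' →ₗ[R] B'),
      IsSES s t ∧ IsSES i q := by
  have hl' : ∀ x, l (f x) = a x := LinearMap.congr_fun hl
  let s : E →ₗ[R] P × Q := l.prod (b ∘ₗ g)
  have hs : ∀ x, s x = (l x, b (g x)) := fun x => rfl
  have hsi : Function.Injective s := by
    rw [injective_iff_map_eq_zero]
    intro x hx
    rw [hs, Prod.mk_eq_zero, map_eq_zero_iff b hb.inj, h.exact x] at hx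
    obtain ⟨hx1, y, rfl⟩ := hx
    rw [hl', map_eq_zero_iff a ha.inj] at hx1
    rw [hx1, map_zero]
  let N := LinearMap.range s
  have hN : IsSES (B := ModuleCat.of R (P × Q)) (C := ModuleCat.of R ((P × Q) ⧸ N)) s N.mkQ :=
    ⟨hsi, LinearMap.exact_map_mkQ_range _, N.mkQ_surjective⟩
  obtain ⟨i, hi⟩ := ha.exists_desc (Y := ModuleCat.of R ((P × Q) ⧸ N))
    (N.mkQ ∘ₗ LinearMap.inl R P Q) (LinearMap.ext fun x => by
      refine (Submodule.Quotient.mk_eq_zero N).2 ⟨f x, ?_⟩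
      rw [hs, hl', h.exact.apply_apply_eq_zero, map_zero]
      rfl)
  obtain ⟨q, hq⟩ := hN.exists_desc (β ∘ₗ LinearMap.snd R P Q)
    (LinearMap.ext fun x => hb.exact.apply_apply_eq_zero (g x))
  have hi' : ∀ p, i (α p) = N.mkQ (p, 0) := LinearMap.congr_fun hi
  have hq' : ∀ z, q (N.mkQ z) = β z.2 := LinearMap.congr_fun hq
  refine ⟨_, s, N.mkQ, i, q, hN, ?_, ?_, ?_⟩
  · rw [injective_iff_map_eq_zero]
    intro x hx
    obtain ⟨p, rfl⟩ := ha.surj x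
    rw [hi'] at hx
    obtain ⟨y, hy⟩ := (hN.exact _).1 hx
    rw [hs, Prod.mk.injEq, map_eq_zero_iff b hb.inj, h.exact y] at hy
    obtain ⟨hy1, z, rfl⟩ := hy
    rw [← hy1, hl', ha.exact.apply_apply_eq_zero]
  · intro w
    obtain ⟨⟨p, y⟩, rfl⟩ := N.mkQ_surjective w
    rw [hq']
    constructor
    · intro hy
      obtain ⟨x, hx⟩ := (hb.exact y).1 hy
      obtain ⟨e, rfl⟩ := h.surj x
      refine ⟨α (p - l e), ?_⟩
      rw [hi', ← sub_eq_zero, ← map_sub]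
      refine (Submodule.Quotient.mk_eq_zero N).2 ⟨-e, ?_⟩
      rw [map_neg, hs, hx]
      simp
    · rintro ⟨x, hx⟩
      obtain ⟨p', rfl⟩ := ha.surj x
      rw [← hq' (p, y), ← hx, hi', hq', map_zero]
  · intro y
    obtain ⟨z, rfl⟩ := hb.surj y
    exact ⟨N.mkQ (0, z), hq' (0, z)⟩

/-- `W` is finitely generated, `Ext^i(W, R) = 0` for `i > 0`, and `W` embeds in a finitely
generated projective module with cokernel in `S`. -/
structure IsTRStep (S : ModuleCat.{u} R → Prop) (W : ModuleCat.{u} R) : Prop where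
  finite : Module.Finite R W
  ext : ∀ i, Subsingleton (Ext W (ModuleCat.of R R) (i + 1))
  embed : ∃ (P W' : ModuleCat.{u} R) (f : W →ₗ[R] P) (g : P →ₗ[R] W'),
    IsSES f g ∧ IsFGProjective P ∧ S W'

/-- Totally reflexive modules, as the largest class of modules `W` with `Ext^i(W, R) = 0` for
`i > 0` which embed in a finitely generated projective module with cokernel in the class. -/
def IsTR (V : ModuleCat.{u} R) : Prop :=
  ∃ S : ModuleCat.{u} R → Prop, S V ∧ ∀ W, S W → IsTRStep S W

lemma IsTRStep.mono {S S' : ModuleCat.{u} R → Prop} (hS : ∀ W, S W → S' W) {W : ModuleCat.{u} R}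
    (h : IsTRStep S W) : IsTRStep S' W := by
  obtain ⟨P, W', f, g, h1, h2, h3⟩ := h.embed
  exact ⟨h.finite, h.ext, P, W', f, g, h1, h2, hS _ h3⟩

namespace IsTR

lemma step {V : ModuleCat.{u} R} (h : IsTR V) : IsTRStep IsTR V := by
  obtain ⟨S, hV, hS⟩ := h
  exact (hS V hV).mono fun W hW => ⟨S, hW, hS⟩

/-- Coinduction: modules satisfying one step over `IsTR` themselves form an admissible class. -/
lemma of_step {V : ModuleCat.{u} R} (h : IsTRStep IsTR V) : IsTR V :=
  ⟨IsTRStep IsTR, h, fun _ hW => hW.mono fun _ => step⟩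

lemma of_isFGProjective {P : ModuleCat.{u} R} (hP : IsFGProjective P) : IsTR P :=
  ⟨IsFGProjective, hP, fun W hW => ⟨hW.1, fun i => hW.ext _ i, W, ModuleCat.of R PUnit.{u + 1},
    LinearMap.id, 0, ⟨fun _ _ h => h, fun x => ⟨fun _ => ⟨x, rfl⟩, fun _ => rfl⟩,
      fun _ => ⟨0, rfl⟩⟩, hW, inferInstanceAs (Module.Finite R PUnit.{u + 1}),
      inferInstanceAs (Module.Projective R PUnit.{u + 1})⟩⟩

lemma ext_left {K : ModuleCat.{u} R} {d : ℕ} (hd : HasInjectiveDimensionLE K d) {V : ModuleCat.{u} R} (hV : IsTR V)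
    (i : ℕ) : Subsingleton (Ext V K (i + 1)) := by
  -- k counts the cosyzygies needed to push the degree past the injective dimension d of K.
  have key : ∀ (k : ℕ) {V : ModuleCat.{u} R}, IsTR V → ∀ i, d ≤ i + k →
      Subsingleton (Ext V K (i + 1)) := by
    intro k
    induction k with
    | zero => exact fun {V} _ i hi => HasInjectiveDimensionLT.subsingleton K (d + 1) _ (by omega) V
    | succ k ih =>
      intro V hV i hi
      obtain ⟨P, V', f, g, h, hP, hV'⟩ := hV.step.embed
      exact h.ext_left_of_mid' (hP.ext K i) (ih hV' (i + 1) (by omega))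
  exact key d hV i (by omega)

variable [IsNoetherianRing R]

/-- The witnessing class consists of all such extensions. Ext^1(D,P) = 0 extends A → P to the middle
term, so the embeddings of the ends combine with cokernel again an extension. -/
lemma extension {A B D : ModuleCat.{u} R} {f : A →ₗ[R] B} {g : B →ₗ[R] D} (h : IsSES f g)
    (hA : IsTR A) (hD : IsTR D) : IsTR B := by
  refine ⟨fun E => ∃ (A D : ModuleCat.{u} R) (f : A →ₗ[R] E) (g : E →ₗ[R] D),
    IsSES f g ∧ IsTR A ∧ IsTR D, ⟨A, D, f, g, h, hA, hD⟩, ?_⟩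
  rintro E ⟨A, D, f, g, h, hA, hD⟩
  obtain ⟨P, A', a, α, ha, hP, hA'⟩ := hA.step.embed
  obtain ⟨Q, D', b, β, hb, hQ, hD'⟩ := hD.step.embed
  obtain ⟨l, hl⟩ := h.extend_of_ext (hP.isSummandOfPower.ext_right (hD.step.ext 0)) a
  obtain ⟨E', s, t, i, q, h1, h2⟩ := h.cohorseshoe ha hb l hl
  exact ⟨h.finite_mid hA.step.finite hD.step.finite,
    fun i => h.ext_mid' (hA.step.ext i) (hD.step.ext i), _, E', s, t, h1,
    isResolving_fgProjective.prod hP hQ, A', D', i, q, h2, hA', hD'⟩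

/-- If B embeds in P with cokernel B', then A embeds in P with cokernel an extension of B' by D. -/
lemma kernel {A B D : ModuleCat.{u} R} {f : A →ₗ[R] B} {g : B →ₗ[R] D} (h : IsSES f g)
    (hB : IsTR B) (hD : IsTR D) : IsTR A := by
  obtain ⟨P, B', i, c, h', hP, hB'⟩ := hB.step.embed
  obtain ⟨W, q, j, r, h1, h2⟩ := h.comp_mono h'
  exact of_step ⟨h.finite_left hB.step.finite,
    fun i => h.ext_left_of_mid' (hB.step.ext i) (hD.step.ext (i + 1)), P, W, _, q, h1, hP,
    extension h2 hD hB'⟩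

lemma isResolving : IsResolving (R := R) IsTR where
  finite h := h.step.finite
  projective _ h1 h2 := of_isFGProjective ⟨h1, h2⟩
  extension := extension
  kernel := kernel

lemma exists_cover {V : ModuleCat.{u} R} (hV : IsTR V) :
    ∃ (W P : ModuleCat.{u} R) (f : W →ₗ[R] P) (g : P →ₗ[R] V),
      IsSES f g ∧ IsFGProjective P ∧ IsTR W := by
  have := hV.step.finite
  obtain ⟨W, P, f, g, h, hP⟩ := Colinkage.exists_cover V
  exact ⟨W, P, f, g, h, hP, kernel h (of_isFGProjective hP) hV⟩

variable {K : ModuleCat.{u} R}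

lemma ext_dual_left (hK : IsDualizing K) {V : ModuleCat.{u} R} (hV : IsTR V) (i : ℕ) :
    Subsingleton (Ext (homK V K) K (i + 1)) := by
  obtain ⟨d, hd⟩ := hK.finite_injectiveDimension
  have key : ∀ (k : ℕ) {V : ModuleCat.{u} R}, IsTR V → ∀ i, d ≤ i + k →
      Subsingleton (Ext (homK V K) K (i + 1)) := by
    intro k
    induction k with
    | zero => exact fun {V} _ i hi => HasInjectiveDimensionLT.subsingleton K (d + 1) _ (by omega) _
    | succ k ih =>
      intro V hV i hi
      -- Dualizing into K turns the syzygy W of V into a cosyzygy of Hom(V,K), so the degree again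
      -- rises until it exceeds d.
      obtain ⟨W, P, f, g, h, hP, hW⟩ := hV.exists_cover
      exact (h.hom_contra (h.extend_of_ext (hV.ext_left hd 0))).ext_left_of_mid'
        ((hP.isKProjective_dual K).isSummandOfPower.ext_left (hK.ext_eq_zero _ i.succ_pos))
        (ih hW (i + 1) (by omega))
  exact key d hV i (by omega)

lemma ext_dual_right (hK : IsDualizing K) {V : ModuleCat.{u} R} (hV : IsTR V) :
    Subsingleton (Ext K (homK V K) 1) := by
  obtain ⟨d, hd⟩ := hK.finite_injectiveDimension
  obtain ⟨W, P, f, g, h, hP, hW⟩ := hV.exists_cover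
  refine (h.hom_contra (h.extend_of_ext (hV.ext_left hd 0))).ext_one_of_lift
    (hK.ext_K_eq_zero (hP.isKProjective_dual K).isSummandOfPower 0) fun c => ?_
  have hs := hK.toIsSemidualizing
  -- A map K → Hom(W,K) is, by swapping arguments, a map W → Hom(K,K) ≅ R; it extends to P because
  -- Ext^1(V,R) = 0, and swapping back gives the lift.
  obtain ⟨b, hb⟩ := h.extend_of_ext (hV.step.ext 0) (hs.homothety.symm.toLinearMap ∘ₗ c.flip)
  refine ⟨(LinearMap.lsmul R K ∘ₗ b).flip, ?_⟩
  ext k w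
  change b (f w) • k = c k w
  have h1 : b (f w) = hs.homothety.symm (c.flip w) := LinearMap.congr_fun hb w
  rw [h1, hs.homothety_symm_smul]
  rfl

end IsTR

end TotallyReflexive

/-! ### Totally P_K-acyclic complexes and the dual pair for G(P_K) -/

section KSequence

variable {R : Type u} [CommRing R]

/-- A totally `P_K`-acyclic complex, cut into short exact sequences
`0 → Z (i + 1) → X i → Z i → 0`. -/
structure KSequence (K : ModuleCat.{u} R) where
  Z : ℤ → ModuleCat.{u} R
  X : ℤ → ModuleCat.{u} R
  ι : ∀ i, Z (i + 1) →ₗ[R] X i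
  π : ∀ i, X i →ₗ[R] Z i
  ses : ∀ i, IsSES (ι i) (π i)
  mem : ∀ i, IsKProjective K (X i)
  lift : ∀ {T : ModuleCat.{u} R}, IsKProjective K T → ∀ i (c : T →ₗ[R] Z i),
    ∃ b : T →ₗ[R] X i, π i ∘ₗ b = c
  extend : ∀ {T : ModuleCat.{u} R}, IsKProjective K T → ∀ i (a : Z (i + 1) →ₗ[R] T),
    ∃ b : X i →ₗ[R] T, b ∘ₗ ι i = a

namespace KSequence

variable {K : ModuleCat.{u} R} (S : KSequence K)

/-- The complex obtained by splicing the short exact sequences. -/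
def complex : ChainComplex (ModuleCat.{u} R) ℤ :=
  ChainComplex.of S.X (fun i => ModuleCat.ofHom (S.ι i ∘ₗ S.π (i + 1))) fun i => by
    ext x
    change S.ι i (S.π (i + 1) (S.ι (i + 1) (S.π (i + 1 + 1) x))) = 0
    rw [(S.ses (i + 1)).exact.apply_apply_eq_zero, map_zero]

lemma complex_d (i : ℤ) :
    S.complex.d (i + 1) i = ModuleCat.ofHom (S.ι i ∘ₗ S.π (i + 1)) :=
  ChainComplex.of_d S.X (fun i => ModuleCat.ofHom (S.ι i ∘ₗ S.π (i + 1))) i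

lemma range_complex_d (i : ℤ) :
    LinearMap.range (S.complex.d (i + 1) i).hom = LinearMap.ker (S.π i) := by
  rw [complex_d, LinearMap.exact_iff.1 (S.ses i).exact]
  exact LinearMap.range_comp_of_range_eq_top _ (LinearMap.range_eq_top.2 (S.ses (i + 1)).surj)

lemma isTotallyPKAcyclic : IsTotallyPKAcyclic K S.complex where
  mem := S.mem
  exact i := by
    obtain ⟨i, rfl⟩ : ∃ j, i = j + 1 := ⟨i - 1, by ring⟩
    rw [add_sub_cancel_right]
    suffices H : LinearMap.ker (S.complex.d (i + 1) i).hom =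
        LinearMap.range (S.complex.d (i + 1 + 1) (i + 1)).hom from LinearMap.exact_iff.2 H
    rw [range_complex_d, complex_d]
    exact LinearMap.ker_comp_of_ker_eq_bot _ (LinearMap.ker_eq_bot.2 (S.ses i).inj)
  exact_hom_from T hT i := by
    obtain ⟨i, rfl⟩ : ∃ j, i = j + 1 := ⟨i - 1, by ring⟩
    rw [add_sub_cancel_right, complex_d, complex_d]
    intro f
    constructor
    · intro hf
      have h1 : S.π (i + 1) ∘ₗ f.hom = 0 := by
        ext x
        exact (S.ses i).inj ((LinearMap.congr_fun (congrArg ModuleCat.Hom.hom hf) x).trans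
          (map_zero _).symm)
      obtain ⟨c, hc⟩ := (S.ses (i + 1)).exists_factor f.hom h1
      obtain ⟨b, hb⟩ := S.lift hT _ c
      refine ⟨ModuleCat.ofHom b, ModuleCat.hom_ext ?_⟩
      change S.ι (i + 1) ∘ₗ (S.π (i + 1 + 1) ∘ₗ b) = f.hom
      rw [hb, hc]
    · rintro ⟨b, rfl⟩
      ext x
      change S.ι i (S.π (i + 1) (S.ι (i + 1) (S.π (i + 1 + 1) (b.hom x)))) = 0
      rw [(S.ses (i + 1)).exact.apply_apply_eq_zero, map_zero]
  exact_hom_to T hT i := by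
    obtain ⟨i, rfl⟩ : ∃ j, i = j + 1 := ⟨i - 1, by ring⟩
    rw [add_sub_cancel_right, complex_d, complex_d]
    intro f
    constructor
    · intro hf
      have h1 : f.hom ∘ₗ S.ι (i + 1) = 0 := by
        ext x
        obtain ⟨y, rfl⟩ := (S.ses (i + 1 + 1)).surj x
        exact LinearMap.congr_fun (congrArg ModuleCat.Hom.hom hf) y
      obtain ⟨c, hc⟩ := (S.ses (i + 1)).exists_desc f.hom h1
      obtain ⟨b, hb⟩ := S.extend hT _ c
      refine ⟨ModuleCat.ofHom b, ModuleCat.hom_ext ?_⟩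
      change (b ∘ₗ S.ι i) ∘ₗ S.π (i + 1) = f.hom
      rw [hb, hc]
    · rintro ⟨b, rfl⟩
      ext x
      change b.hom (S.ι i (S.π (i + 1) (S.ι (i + 1) (S.π (i + 1 + 1) x)))) = 0
      rw [(S.ses (i + 1)).exact.apply_apply_eq_zero, map_zero]
      exact map_zero b.hom

lemma isGPK {M : ModuleCat.{u} R} (e : M ≃ₗ[R] S.Z 0) : IsGPK K M := by
  have key : ∀ N : Submodule R (S.X 0), N = LinearMap.ker (S.π 0) →
      Nonempty (M ≃ₗ[R] S.X 0 ⧸ N) := by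
    rintro _ rfl
    exact ⟨e.trans ((S.π 0).quotKerEquivOfSurjective (S.ses 0).surj).symm⟩
  exact ⟨S.complex, S.isTotallyPKAcyclic, key _ (S.range_complex_d 0)⟩

end KSequence

namespace IsTotallyPKAcyclic

variable {K : ModuleCat.{u} R} {X : ChainComplex (ModuleCat.{u} R) ℤ}
  (h : IsTotallyPKAcyclic K X)
include h

lemma exact' (i : ℤ) :
    Function.Exact (X.d (i + 1 + 1) (i + 1)).hom (X.d (i + 1) i).hom := by
  have := h.exact (i + 1)
  rw [add_sub_cancel_right] at this
  exact this

/-- The map `coker (X (i + 2) → X (i + 1)) → X i`. -/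
def cokerι (i : ℤ) :
    (X.X (i + 1) ⧸ LinearMap.range (X.d (i + 1 + 1) (i + 1)).hom) →ₗ[R] X.X i :=
  (LinearMap.range (X.d (i + 1 + 1) (i + 1)).hom).liftQ (X.d (i + 1) i).hom
    (LinearMap.exact_iff.1 (h.exact' i)).ge

lemma cokerι_mkQ (i : ℤ) (x : X.X (i + 1)) :
    h.cokerι i ((LinearMap.range (X.d (i + 1 + 1) (i + 1)).hom).mkQ x) = (X.d (i + 1) i).hom x :=
  rfl

lemma cokerι_injective (i : ℤ) : Function.Injective (h.cokerι i) := by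
  rw [← LinearMap.ker_eq_bot]
  exact Submodule.ker_liftQ_eq_bot _ _ _ (LinearMap.exact_iff.1 (h.exact' i)).le

/-- The short exact sequences of a totally `P_K`-acyclic complex. -/
def kSequence : KSequence K where
  Z i := ModuleCat.of R (X.X i ⧸ LinearMap.range (X.d (i + 1) i).hom)
  X := X.X
  ι i := h.cokerι i
  π i := (LinearMap.range (X.d (i + 1) i).hom).mkQ
  ses i := by
    refine ⟨h.cokerι_injective i, ?_, Submodule.mkQ_surjective _⟩
    rw [LinearMap.exact_iff, Submodule.ker_mkQ]
    exact (Submodule.range_liftQ _ _ _).symm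
  mem := h.mem
  lift {T} hT i c := by
    obtain ⟨i, rfl⟩ : ∃ k, i = k + 1 + 1 := ⟨i - 1 - 1, by ring⟩
    have hex := h.exact_hom_from T hT (i + 1)
    rw [add_sub_cancel_right] at hex
    -- Followed by the embedding of the cokernel into the next term, c becomes a cycle of Hom(T,X);
    -- a preimage under the differential is the required lift.
    obtain ⟨b, hb⟩ := (hex (ModuleCat.ofHom (h.cokerι (i + 1) ∘ₗ c))).1 (ModuleCat.hom_ext
      (LinearMap.ext fun x => by
        obtain ⟨y, hy⟩ := Submodule.mkQ_surjective _ (c x)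
        change (X.d (i + 1) i).hom (h.cokerι (i + 1) (c x)) = 0
        rw [← hy, cokerι_mkQ]
        exact (h.exact' i).apply_apply_eq_zero y))
    refine ⟨b.hom, LinearMap.ext fun x => h.cokerι_injective (i + 1) ?_⟩
    exact LinearMap.congr_fun (congrArg ModuleCat.Hom.hom hb) x
  extend {T} hT i a := by
    have hex := h.exact_hom_to T hT (i + 1)
    rw [add_sub_cancel_right] at hex
    let N := LinearMap.range (X.d (i + 1 + 1) (i + 1)).hom
    obtain ⟨b, hb⟩ := (hex (ModuleCat.ofHom (a ∘ₗ N.mkQ))).1 (ModuleCat.hom_ext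
      (LinearMap.ext fun x => by
        have h1 : N.mkQ ((X.d (i + 1 + 1) (i + 1)).hom x) = 0 :=
          (Submodule.Quotient.mk_eq_zero N).2 ⟨x, rfl⟩
        change a (N.mkQ ((X.d (i + 1 + 1) (i + 1)).hom x)) = 0
        rw [h1, map_zero]))
    refine ⟨b.hom, LinearMap.ext fun x => ?_⟩
    obtain ⟨y, rfl⟩ := Submodule.mkQ_surjective _ x
    exact LinearMap.congr_fun (congrArg ModuleCat.Hom.hom hb) y

end IsTotallyPKAcyclic

lemma IsGPK.exists_kSequence {K M : ModuleCat.{u} R} (h : IsGPK K M) :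
    ∃ S : KSequence K, Nonempty (M ≃ₗ[R] S.Z 0) := by
  obtain ⟨X, hX, e⟩ := h
  exact ⟨hX.kSequence, e⟩

namespace KSequence

variable {K : ModuleCat.{u} R} (S : KSequence K)

/-- Z (i+1) sits inside X i with cokernel Z i, so degree j for one cocycle module follows from
degree j - 1 for the next. The complex never ends, so the induction is uniform in i. -/
lemma ext_of_ext (N : ModuleCat.{u} R) (n : ℕ) (h : ∀ i < n, Subsingleton (Ext N K i))
    (j : ℕ) (hj : j < n) (i : ℤ) : Subsingleton (Ext N (S.Z i) j) := by
  induction j generalizing i with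
  | zero =>
    obtain ⟨i, rfl⟩ : ∃ k, i = k + 1 := ⟨i - 1, by ring⟩
    exact (S.ses i).ext_zero_left ((S.mem i).isSummandOfPower.ext_right (h 0 hj))
  | succ j ih =>
    obtain ⟨i, rfl⟩ : ∃ k, i = k + 1 := ⟨i - 1, by ring⟩
    exact (S.ses i).ext_left_of_mid ((S.mem i).isSummandOfPower.ext_right (h _ hj))
      (ih (by omega) i)

lemma ses_homK (i : ℤ) : IsSES (A := homK K (S.Z (i + 1))) (B := homK K (S.X i))
    (C := homK K (S.Z i)) ((S.ι i).compRight R) ((S.π i).compRight R) :=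
  (S.ses i).hom_co (S.lift (isKProjective_self K) i)

variable (hK : IsSemidualizing K)
include hK

lemma ext_K (i : ℤ) (j : ℕ) : Subsingleton (Ext K (S.Z i) (j + 1)) := by
  induction j generalizing i with
  | zero =>
    obtain ⟨i, rfl⟩ : ∃ k, i = k + 1 := ⟨i - 1, by ring⟩
    exact (S.ses i).ext_one_of_lift (hK.ext_K_eq_zero (S.mem i).isSummandOfPower 0)
      (S.lift (isKProjective_self K) i)
  | succ j ih =>
    obtain ⟨i, rfl⟩ : ∃ k, i = k + 1 := ⟨i - 1, by ring⟩
    exact (S.ses i).ext_left_of_mid (hK.ext_K_eq_zero (S.mem i).isSummandOfPower (j + 1)) (ih i)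

lemma evK_bijective (i : ℤ) : Function.Bijective (evK K (S.Z i)) := by
  have hsurj : ∀ i, Function.Surjective (evK K (S.Z i)) := by
    intro i z
    obtain ⟨x, rfl⟩ := (S.ses i).surj z
    obtain ⟨t, rfl⟩ := (hK.evK_bijective (S.mem i).isSummandOfPower).2 x
    exact ⟨_, evK_naturality K (S.π i) t⟩
  exact (S.ses i).evK_bijective (S.lift (isKProjective_self K) i) (hsurj (i + 1))
    (hK.evK_bijective (S.mem i).isSummandOfPower)

lemma isFGProjective_homK (i : ℤ) : IsFGProjective (homK K (S.X i)) :=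
  hK.homK_finite_projective (S.mem i).isSummandOfPower

/-- A functional a on Hom(K,Z) induces K ⊗ Hom(K,Z) → K, k ⊗ c ↦ a(c)k, that is, a map Z → K through
evaluation. This extends to X i → K, and applying Hom(K,-) with Hom(K,K) ≅ R returns an extension of
a. -/
lemma extend_homK (i : ℤ) (a : homK K (S.Z (i + 1)) →ₗ[R] ModuleCat.of R R) :
    ∃ b : homK K (S.X i) →ₗ[R] ModuleCat.of R R, b ∘ₗ (S.ι i).compRight R = a := by
  let w : K ⊗[R] (K →ₗ[R] S.Z (i + 1)) →ₗ[R] K :=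
    TensorProduct.lift (LinearMap.lsmul R K ∘ₗ a).flip
  let e := LinearEquiv.ofBijective _ (S.evK_bijective hK (i + 1))
  obtain ⟨v, hv⟩ := S.extend (isKProjective_self K) i (w ∘ₗ e.symm.toLinearMap)
  refine ⟨hK.homothety.symm.toLinearMap ∘ₗ v.compRight R, LinearMap.ext fun c => ?_⟩
  change hK.homothety.symm (v ∘ₗ (S.ι i ∘ₗ c)) = a c
  rw [LinearEquiv.symm_apply_eq, ← LinearMap.comp_assoc, hv]
  ext k
  have : e.symm (c k) = k ⊗ₜ c := by
    rw [LinearEquiv.symm_apply_eq]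
    rfl
  change w (e.symm (c k)) = _
  rw [this]
  rfl

lemma ext_homK (i : ℤ) (j : ℕ) :
    Subsingleton (Ext (homK K (S.Z i)) (ModuleCat.of R R) (j + 1)) := by
  induction j generalizing i with
  | zero =>
    exact (S.ses_homK i).ext_one_of_extend ((S.isFGProjective_homK hK i).ext _ 0)
      (S.extend_homK hK i)
  | succ j ih =>
    exact (S.ses_homK i).ext_right_of_mid' ((S.isFGProjective_homK hK i).ext _ (j + 1))
      (ih (i + 1))

lemma isTR_homK (i : ℤ) : IsTR (homK K (S.Z i)) := by
  refine ⟨fun W => ∃ i, W = homK K (S.Z i), ⟨i, rfl⟩, ?_⟩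
  rintro _ ⟨i, rfl⟩
  refine ⟨?_, S.ext_homK hK i, ?_⟩
  · have := (S.isFGProjective_homK hK i).1
    exact Module.Finite.of_surjective _ (S.ses_homK i).surj
  · obtain ⟨i, rfl⟩ : ∃ k, i = k + 1 := ⟨i - 1, by ring⟩
    exact ⟨_, _, _, _, S.ses_homK i, S.isFGProjective_homK hK i, i, rfl⟩

end KSequence

lemma exists_int_sequence {α : Type*} (r : α → α → Prop) (h₁ : ∀ a, ∃ b, r a b)
    (h₂ : ∀ b, ∃ a, r a b) (a : α) : ∃ s : ℤ → α, s 0 = a ∧ ∀ i, r (s i) (s (i + 1)) := by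
  choose f hf using h₁
  choose g hg using h₂
  refine ⟨fun i => match i with
    | .ofNat n => f^[n] a
    | .negSucc n => g^[n + 1] a, rfl, fun i => ?_⟩
  match i with
  | .ofNat n =>
    change r (f^[n] a) (f^[n + 1] a)
    rw [Function.iterate_succ_apply']
    exact hf _
  | .negSucc 0 => exact hg a
  | .negSucc (n + 1) =>
    change r (g^[n + 1 + 1] a) (g^[n + 1] a)
    rw [Function.iterate_succ_apply' g (n + 1)]
    exact hg _

variable [IsNoetherianRing R]

lemma IsTR.isGPK_dual {K : ModuleCat.{u} R} (hK : IsDualizing K) {V : ModuleCat.{u} R}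
    (hV : IsTR V) : IsGPK K (homK V K) := by
  obtain ⟨d, hd⟩ := hK.finite_injectiveDimension
  -- A complete projective resolution of V, with cosyzygies in positive and syzygies in negative
  -- degrees. Hom(-,K) reverses it, so Hom(s (i+1),K) becomes the kernel in the homological
  -- indexing.
  obtain ⟨s, hs0, hs⟩ := exists_int_sequence (α := {V : ModuleCat.{u} R // IsTR V})
    (fun V V' => ∃ (P : ModuleCat.{u} R) (f : V.1 →ₗ[R] P) (g : P →ₗ[R] V'.1),
      IsSES f g ∧ IsFGProjective P)
    (fun V => by
      obtain ⟨P, W, f, g, h, hP, hW⟩ := V.2.step.embed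
      exact ⟨⟨W, hW⟩, P, f, g, h, hP⟩)
    (fun V => by
      obtain ⟨W, P, f, g, h, hP, hW⟩ := V.2.exists_cover
      exact ⟨⟨W, hW⟩, P, f, g, h, hP⟩) ⟨V, hV⟩
  choose P f g h hP using hs
  have hses := fun i => (h i).hom_contra (Y := K)
    ((h i).extend_of_ext ((s (i + 1)).2.ext_left hd 0))
  let S : KSequence K :=
    { Z := fun i => homK (s i).1 K
      X := fun i => homK (P i) K
      ι := fun i => (g i).lcomp R K
      π := fun i => (f i).lcomp R K
      ses := hses
      mem := fun i => (hP i).isKProjective_dual K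
      lift := fun {T} hT i c => (hses i).lift_of_ext
        (hT.isSummandOfPower.ext_left ((s (i + 1)).2.ext_dual_right hK)) c
      extend := fun {T} hT i a => (hses i).extend_of_ext
        (hT.isSummandOfPower.ext_right ((s i).2.ext_dual_left hK 0)) a }
  have e : homK V K ≃ₗ[R] S.Z 0 := by
    change homK V K ≃ₗ[R] homK (s 0).1 K
    rw [hs0]
  exact S.isGPK e

lemma IsDualizing.isDualPair_isGPK {K : ModuleCat.{u} R} (hK : IsDualizing K) :
    IsDualPair K IsTR (IsGPK K) where
  resolving := IsTR.isResolving
  ext_left hV i := by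
    obtain ⟨d, hd⟩ := hK.finite_injectiveDimension
    exact hV.ext_left hd i
  dual hV := hV.isGPK_dual hK
  equiv hX e := by
    obtain ⟨S, ⟨e'⟩⟩ := hX.exists_kSequence
    exact S.isGPK (e.trans e')
  ext_right hX i := by
    obtain ⟨S, ⟨e⟩⟩ := hX.exists_kSequence
    exact ext_subsingleton_of_equiv_right e (S.ext_K hK.toIsSemidualizing 0 i)
  bijective_evK hX := by
    obtain ⟨S, ⟨e⟩⟩ := hX.exists_kSequence
    refine IsSES.evK_bijective (Z' := ModuleCat.of R PUnit.{u + 1}) (f := 0)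
      (g := e.symm.toLinearMap) ((isSES_zero_id (S.Z 0)).comp_equiv_right e.symm)
      (fun c => ⟨e.toLinearMap ∘ₗ c, by ext; simp⟩) (fun _ => ⟨0, rfl⟩)
      (S.evK_bijective hK.toIsSemidualizing 0)
  homK_mem hX := by
    obtain ⟨S, ⟨e⟩⟩ := hX.exists_kSequence
    have h := (isSES_zero_id (homK K (S.Z 0))).comp_equiv_right
      (C' := homK K _) (LinearEquiv.congrRight e.symm)
    -- Invariance of `IsTR` under isomorphism, obtained by viewing Hom(K,X) as the kernel of Hom(K,Z
    -- 0) → 0.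
    exact IsTR.kernel (IsSES.comp_equiv_left (A := homK K (S.Z 0)) (B := homK K (S.Z 0))
      (C := ModuleCat.of R PUnit.{u + 1}) (f := LinearMap.id) (g := 0)
      ⟨fun _ _ h => h, fun x => ⟨fun _ => ⟨x, rfl⟩, fun _ => rfl⟩, fun _ => ⟨0, rfl⟩⟩
      (LinearEquiv.congrRight e)) (S.isTR_homK hK.toIsSemidualizing 0) IsTR.isResolving.zero
  ext_of_ext hX N n h i hi := by
    obtain ⟨S, ⟨e⟩⟩ := hX.exists_kSequence
    exact ext_subsingleton_of_equiv_right e (S.ext_of_ext N n h i hi 0)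

end KSequence

/-! ### Invariance along coliaison classes -/

section Main

variable {R : Type u} [CommRing R] [IsNoetherianRing R]

lemma IsEpiOf.dimLE {K : ModuleCat.{u} R} (hK : IsSemidualizing K)
    {C D : ModuleCat.{u} R → Prop} (h : IsDualPair K C D) {n : ℕ} {Y M N Y' : ModuleCat.{u} R}
    {φ : Y ⟶ M} (hφ : IsEpiOf (PKPerfectOfGrade K n) φ) {ψ : Y' ⟶ N}
    (hψ : EquivHom ψ (colinkHom K n φ)) (hM : DimLE D n M) : DimLE D n N := by
  obtain ⟨⟨⟨hY1, hY2⟩, hY3⟩, hM1, hsurj, -⟩ := hφ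
  obtain ⟨e, -, -⟩ := hψ
  have hY := (hK.isDualPair_isKProjective.grade_eq_iff hK hY3).1 hY2
  exact (h.dimLE_colink hK φ hsurj hY3 (hY.mono fun X hX => h.mem_of_isKProjective hX)
    hM).of_equiv h.equiv e.toLinearEquiv

lemma DirectlyColinked.perfect_iff {K : ModuleCat.{u} R} (hK : IsSemidualizing K)
    {C D : ModuleCat.{u} R → Prop} (h : IsDualPair K C D) {n : ℕ} {M N : ModuleCat.{u} R}
    (hMN : DirectlyColinked K n (PKPerfectOfGrade K n) M N) :
    (Module.Finite R M ∧ (grade M : WithBot ℕ∞) = resolutionDim D M) ↔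
      (Module.Finite R N ∧ (grade N : WithBot ℕ∞) = resolutionDim D N) := by
  obtain ⟨Y, Y', φ, ψ, hφ, hψ, h1, h2⟩ := hMN
  have := hφ.finite
  have := hψ.finite
  rw [h.grade_eq_iff hK (hφ.grade_eq.trans hφ.mem.2),
    h.grade_eq_iff hK (hψ.grade_eq.trans hψ.mem.2)]
  exact ⟨fun H => ⟨hψ.finite, hφ.dimLE hK h h2 H.2⟩, fun H => ⟨hφ.finite, hψ.dimLE hK h h1 H.2⟩⟩

lemma SameColiaisonClass.perfect_iff {K : ModuleCat.{u} R} (hK : IsSemidualizing K)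
    {C D : ModuleCat.{u} R → Prop} (h : IsDualPair K C D) {n : ℕ} {M N : ModuleCat.{u} R}
    (hMN : SameColiaisonClass K n (PKPerfectOfGrade K n) M N) :
    (Module.Finite R M ∧ (grade M : WithBot ℕ∞) = resolutionDim D M) ↔
      (Module.Finite R N ∧ (grade N : WithBot ℕ∞) = resolutionDim D N) := by
  induction hMN with
  | rel _ _ h' => exact h'.perfect_iff hK h
  | refl _ => exact Iff.rfl
  | symm _ _ _ ih => exact ih.symm
  | trans _ _ _ _ _ ih₁ ih₂ => exact ih₁.trans ih₂

end Main

end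

end Colinkage

theorem mainTheorem10 {R : Type u} [CommRing R] [IsNoetherianRing R]
    (K : ModuleCat.{u} R) (hK : Colinkage.IsSemidualizing K) (n : ℕ)
    (M N : ModuleCat.{u} R) (hM : Module.Finite R M) (hN : Module.Finite R N)
    (hMN : Colinkage.SameColiaisonClass K n (Colinkage.PKPerfectOfGrade K n) M N) :
    (Colinkage.IsPKPerfect K M ↔ Colinkage.IsPKPerfect K N) ∧
      (Colinkage.IsDualizing K →
        (Colinkage.IsGPKPerfect K M ↔ Colinkage.IsGPKPerfect K N)) :=
  ⟨hMN.perfect_iff hK hK.isDualPair_isKProjective,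
    fun hD => hMN.perfect_iff hK hD.isDualPair_isGPK⟩
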